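/- Conventions. For an integral domain $A$ with quotient field $F$ and a nonzero fractional ideal $I$ of $A$, put $I^{-1}=\{x\in F\mid xI\subseteq A\}$, $I_v=(I^{-1})^{-1}$ and $I_t=\bigcup J_v$, the union being over all nonzero finitely generated fractional ideals $J\subseteq I$. A $t$-ideal of $A$ is a nonzero ideal $I\subseteq A$ with $I_t=I$, and $t\text{-}\mathrm{Max}(A)$ is the set of ideals that are maximal among the proper $t$-ideals of $A$ (these are prime). The domain $A$ is a $t\#$-domain if $\bigcap_{M\in\mathcal M_1}A_M\neq\bigcap_{M\in\mathcal M_2}A_M$ for any two distinct subsets $\mathcal M_1,\mathcal M_2$ of $t\text{-}\mathrm{Max}(A)$ (intersections in $F$; the empty intersection is $F$). It is $v$-coherent if for each nonzero finitely generated ideal $I$ of $A$ there is a finitely generated fractional ideal $J$ of $A$ with $I^{-1}=J_v$. Theorem. Let $R$ be an integral domain and $\{X_\alpha\}$ a set of independent indeterminates over $R$. For $f\in R[\{X_\alpha\}]$ let $c(f)$ be the ideal of $R$ generated by the coefficients of $f$. Let $R(\{X_\alpha\})$ be the ring of fractions of $R[\{X_\alpha\}]$ with respect to the multiplicatively closed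 set $\{f\mid c(f)=R\}$, and let $R\langle\{X_\alpha\}\rangle$ be the ring of fractions of $R[\{X_\alpha\}]$ with respect to the multiplicatively closed set $\{f\mid f\neq 0,\ c(f)_v=R\}$. Then the following statements are equivalent: 1. $R[\{X_\alpha\}]$ is a $t\#$-domain; 2. $R(\{X_\alpha\})$ is a $t\#$-domain; 3. $R\langle\{X_\alpha\}\rangle$ is a $t\#$-domain. If, in addition, $R[\{X_\alpha\}]$ is $v$-coherent, then each of these statements is equivalent to: $R$ is a $t\#$-domain. -/

import Mathlib

open scoped nonZeroDivisors

section StarOperations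

variable {A : Type*} (K : Type*) [CommRing A] [IsDomain A] [Field K] [Algebra A K]
  [IsFractionRing A K]

/-- The divisorial closure `I_v = (I⁻¹)⁻¹` of a nonzero fractional ideal `I` of the domain `A` with
quotient field `K`; here `I⁻¹ = (A :_K I)`.  (By Mathlib's convention `0⁻¹ = 0`, so the value
at the zero ideal is `0`; it is never relevant below.) -/
noncomputable def vClosure {K : Type*} [Field K] [Algebra A K] [IsFractionRing A K]
    (I : FractionalIdeal A⁰ K) : FractionalIdeal A⁰ K :=
  (I⁻¹)⁻¹

/-- The `t`-closure `I_t = ⋃ J_v` of a fractional ideal `I`, the union being taken over the nonzero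
finitely generated fractional ideals `J ⊆ I`, as a subset of `K`. -/
def tClosure {K : Type*} [Field K] [Algebra A K] [IsFractionRing A K]
    (I : FractionalIdeal A⁰ K) : Set K :=
  {x | ∃ J : FractionalIdeal A⁰ K, J ≠ 0 ∧ (J : Submodule A K).FG ∧ J ≤ I ∧ x ∈ vClosure J}

/-- An (integral) `t`-ideal of `A`: a nonzero ideal `I` with `I_t = I`. -/
def IsTIdeal (I : Ideal A) : Prop :=
  I ≠ ⊥ ∧ tClosure (I : FractionalIdeal A⁰ K) = {x | x ∈ (I : FractionalIdeal A⁰ K)}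

variable (A) in
/-- The set `t-Max(A)` of maximal `t`-ideals of `A`: the ideals that are maximal with respect to
inclusion among the proper `t`-ideals. -/
def tMax : Set (Ideal A) :=
  {M | Maximal (fun I : Ideal A => I ≠ ⊤ ∧ IsTIdeal K I) M}

/-- The localization `A_M`, as a subset of `K`: the fractions `a / s` with `a ∈ A` and
`s ∈ A \ M`. It is used for prime ideals `M` only (maximal `t`-ideals are prime). -/
def localizationAt (M : Ideal A) : Set K :=
  {x | ∃ a s : A, s ∉ M ∧ x = algebraMap A K a / algebraMap A K s}

variable (A) in
/-- `A` (with quotient field `K`) is a `t#`-domain: `⋂_{M ∈ 𝓜₁} A_M ≠ ⋂_{M ∈ 𝓜₂} A_M` for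
distinct subsets `𝓜₁`, `𝓜₂` of `t-Max(A)`. The intersections are taken in `K`; in particular,
the intersection of the empty family is `K`. -/
def IsTSharpDomain : Prop :=
  ∀ 𝓜₁ 𝓜₂ : Set (Ideal A), 𝓜₁ ⊆ tMax A K → 𝓜₂ ⊆ tMax A K → 𝓜₁ ≠ 𝓜₂ →
    (⋂ M ∈ 𝓜₁, localizationAt K M) ≠ ⋂ M ∈ 𝓜₂, localizationAt K M

variable (A) in
/-- `A` (with quotient field `K`) is `v`-coherent: for each nonzero finitely generated ideal `I`
there is a finitely generated fractional ideal `J` with `I⁻¹ = J_v`. -/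
def IsVCoherent : Prop :=
  ∀ I : Ideal A, I ≠ ⊥ → I.FG →
    ∃ J : FractionalIdeal A⁰ K, (J : Submodule A K).FG ∧
      (I : FractionalIdeal A⁰ K)⁻¹ = vClosure J

end StarOperations

section Content

variable {R : Type*} {σ : Type*} [CommRing R]

/-- The content `c(f)`: the ideal of `R` generated by the coefficients of `f`. -/
def polyContent (f : MvPolynomial σ R) : Ideal R :=
  Ideal.span (f.coeffs : Set R)

theorem polyContent_le_iff (f : MvPolynomial σ R) (P : Ideal R) :
    polyContent f ≤ P ↔ MvPolynomial.map (Ideal.Quotient.mk P) f = 0 := by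
  rw [polyContent, Ideal.span_le]
  constructor
  · intro h
    ext m
    rw [MvPolynomial.coeff_map, MvPolynomial.coeff_zero, Ideal.Quotient.eq_zero_iff_mem]
    by_cases hm : f.coeff m = 0
    · rw [hm]; exact P.zero_mem
    · exact h (MvPolynomial.coeff_mem_coeffs m hm)
  · intro h c hc
    obtain ⟨m, -, rfl⟩ := MvPolynomial.mem_coeffs_iff.1 hc
    have := congrArg (MvPolynomial.coeff m) h
    rwa [MvPolynomial.coeff_map, MvPolynomial.coeff_zero, Ideal.Quotient.eq_zero_iff_mem] at this

theorem polyContent_mul_le_iff (f g : MvPolynomial σ R) (P : Ideal R) [P.IsPrime] :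
    polyContent (f * g) ≤ P ↔ polyContent f ≤ P ∨ polyContent g ≤ P := by
  simp only [polyContent_le_iff, map_mul, mul_eq_zero]

theorem polyContent_one : polyContent (1 : MvPolynomial σ R) = ⊤ := by
  rw [Ideal.eq_top_iff_one]
  rcases subsingleton_or_nontrivial R with h | h
  · rw [Subsingleton.elim (1 : R) 0]; exact Ideal.zero_mem _
  · exact Ideal.subset_span (by simp)

/-- The multiplicatively closed set of the polynomials of unit content, `c(f) = R`. -/
def unitContent (σ R : Type*) [CommRing R] : Submonoid (MvPolynomial σ R) where
  carrier := {f | polyContent f = ⊤}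
  one_mem' := polyContent_one
  mul_mem' := by
    intro f g hf hg
    by_contra h
    obtain ⟨P, hP, hle⟩ := Ideal.exists_le_maximal _ h
    have := hP.isPrime
    rcases (polyContent_mul_le_iff f g P).1 hle with h | h
    · exact hP.ne_top (top_le_iff.1 (hf ▸ h))
    · exact hP.ne_top (top_le_iff.1 (hg ▸ h))

theorem exists_pow_mul_le_of_mem_minimalPrimes {I P J : Ideal R} (hP : P ∈ I.minimalPrimes)
    (hJ : J ≤ P) (hfg : J.FG) : ∃ s ∉ P, ∃ n : ℕ, ∀ r ∈ J ^ n, r * s ∈ I := by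
  classical
  have := hP.1.1
  obtain ⟨T, rfl⟩ := hfg
  have hT : (T : Set R) ⊆ P := Ideal.span_le.1 hJ
  have single : ∀ a ∈ P, ∃ s ∉ P, ∃ n : ℕ, a ^ n * s ∈ I := by
    intro a ha
    have h1 : algebraMap R (Localization.AtPrime P) a ∈
        (I.map (algebraMap R (Localization.AtPrime P))).radical := by
      rw [IsLocalization.AtPrime.radical_map_of_mem_minimalPrimes _ P I hP]
      exact Ideal.mem_map_of_mem _ ha
    obtain ⟨n, hn⟩ := h1
    rw [← map_pow, IsLocalization.algebraMap_mem_map_algebraMap_iff P.primeCompl] at hn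
    obtain ⟨s, hs, h⟩ := hn
    exact ⟨s, hs, n, by rwa [mul_comm]⟩
  have main : ∃ s ∉ P, ∀ a ∈ T, ∃ n : ℕ, a ^ n * s ∈ I := by
    clear hJ
    induction T using Finset.induction_on with
    | empty => exact ⟨1, (Ideal.ne_top_iff_one P).1 this.ne_top, by simp⟩
    | insert a T _ ih =>
      rw [Finset.coe_insert, Set.insert_subset_iff] at hT
      obtain ⟨s, hs, h⟩ := ih hT.2
      obtain ⟨t, ht, n, hn⟩ := single a hT.1
      refine ⟨s * t, fun hst => (this.mem_or_mem hst).elim hs ht, fun b hb => ?_⟩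
      rcases Finset.mem_insert.1 hb with rfl | hb
      · exact ⟨n, by
          rw [show b ^ n * (s * t) = s * (b ^ n * t) by ring]; exact I.mul_mem_left _ hn⟩
      · obtain ⟨m, hm⟩ := h b hb
        exact ⟨m, by rw [← mul_assoc]; exact I.mul_mem_right _ hm⟩
  obtain ⟨s, hs, h⟩ := main
  refine ⟨s, hs, ?_⟩
  have hle : Ideal.span (T : Set R) ≤ (Submodule.colon I {s}).radical := by
    rw [Ideal.span_le]
    intro a ha
    obtain ⟨n, hn⟩ := h a ha
    exact ⟨n, Submodule.mem_colon_singleton.2 hn⟩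
  obtain ⟨n, hn⟩ := Ideal.exists_pow_le_of_le_radical_of_fg hle ⟨T, rfl⟩
  exact ⟨n, fun r hr => Submodule.mem_colon_singleton.1 (hn hr)⟩

variable (K : Type*) [IsDomain R] [Field K] [Algebra R K] [IsFractionRing R K]

theorem vClosure_polyContent_eq_one_iff (f : MvPolynomial σ R) :
    vClosure (polyContent f : FractionalIdeal R⁰ K) = 1 ↔ polyContent f ≠ ⊥ ∧
      ∀ x : K, (∀ r ∈ polyContent f, x * algebraMap R K r ∈ (1 : FractionalIdeal R⁰ K)) →
        x ∈ (1 : FractionalIdeal R⁰ K) := by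
  have key : ∀ h0 : polyContent f ≠ ⊥, ∀ x : K,
      x ∈ (polyContent f : FractionalIdeal R⁰ K)⁻¹ ↔
        ∀ r ∈ polyContent f, x * algebraMap R K r ∈ (1 : FractionalIdeal R⁰ K) := by
    intro h0 x
    rw [FractionalIdeal.mem_inv_iff (FractionalIdeal.coeIdeal_ne_zero.2 h0)]
    constructor
    · intro h r hr
      exact h _ (FractionalIdeal.mem_coeIdeal_of_mem _ hr)
    · intro h y hy
      obtain ⟨r, hr, rfl⟩ := (FractionalIdeal.mem_coeIdeal _).1 hy
      exact h r hr
  constructor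
  · intro h
    have h0 : polyContent f ≠ ⊥ := by
      intro h0
      simp [vClosure, h0, FractionalIdeal.inv_zero'] at h
    refine ⟨h0, fun x hx => ?_⟩
    have h1 : (1 : K) ∈ vClosure (polyContent f : FractionalIdeal R⁰ K) := by
      rw [h]; exact FractionalIdeal.one_mem_one _
    have hne : (polyContent f : FractionalIdeal R⁰ K)⁻¹ ≠ 0 := by
      intro h2
      rw [vClosure, h2, FractionalIdeal.inv_zero'] at h
      exact zero_ne_one h
    have := (FractionalIdeal.mem_inv_iff hne).1 h1 x ((key h0 x).2 hx)
    rwa [one_mul] at this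
  · rintro ⟨h0, h⟩
    have : (polyContent f : FractionalIdeal R⁰ K)⁻¹ = 1 := by
      ext x
      constructor
      · intro hx
        exact h x ((key h0 x).1 hx)
      · intro hx
        rw [key h0]
        intro r _
        obtain ⟨y, rfl⟩ := (FractionalIdeal.mem_one_iff _).1 hx
        rw [← map_mul]
        exact (FractionalIdeal.mem_one_iff _).2 ⟨_, rfl⟩
    rw [vClosure, this, inv_one]

/-- The multiplicatively closed set of the polynomials `f` with `c(f)_v = R`. -/
def unitVContent (σ R K : Type*) [CommRing R] [IsDomain R] [Field K] [Algebra R K]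
    [IsFractionRing R K] : Submonoid (MvPolynomial σ R) where
  carrier := {f | vClosure (polyContent f : FractionalIdeal R⁰ K) = 1}
  one_mem' := by simp [polyContent_one, vClosure]
  mul_mem' := by
    intro f g hf hg
    replace hf := (vClosure_polyContent_eq_one_iff K f).1 hf
    replace hg := (vClosure_polyContent_eq_one_iff K g).1 hg
    refine (vClosure_polyContent_eq_one_iff K (f * g)).2 ?_
    refine ⟨fun h => ?_, fun x hx => ?_⟩
    · rcases (polyContent_mul_le_iff f g ⊥).1 h.le with h | h
      · exact hf.1 (le_bot_iff.1 h)
      · exact hg.1 (le_bot_iff.1 h)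
    by_contra hx1
    let I : Ideal R := ((1 : FractionalIdeal R⁰ K) : Submodule R K).colon {x}
    have hI : ∀ r, r ∈ I ↔ x * algebraMap R K r ∈ (1 : FractionalIdeal R⁰ K) := by
      intro r
      rw [Submodule.mem_colon_singleton, Algebra.smul_def, mul_comm]
      rfl
    have hItop : I ≠ ⊤ := by
      rw [Ideal.ne_top_iff_one, hI, map_one, mul_one]
      exact hx1
    obtain ⟨P, hP⟩ := Ideal.nonempty_minimalPrimes hItop
    have := hP.1.1
    have aux : ∀ f : MvPolynomial σ R,
        (∀ x : K, (∀ r ∈ polyContent f, x * algebraMap R K r ∈ (1 : FractionalIdeal R⁰ K)) →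
          x ∈ (1 : FractionalIdeal R⁰ K)) → ¬ polyContent f ≤ P := by
      intro f hf hle
      obtain ⟨s, hs, n, hn⟩ := exists_pow_mul_le_of_mem_minimalPrimes hP hle ⟨_, rfl⟩
      have pow : ∀ (n : ℕ) (y : K),
          (∀ r ∈ polyContent f ^ n, y * algebraMap R K r ∈ (1 : FractionalIdeal R⁰ K)) →
            y ∈ (1 : FractionalIdeal R⁰ K) := by
        intro n
        induction n with
        | zero =>
          intro y hy
          simpa using hy 1 (by simp)
        | succ n ih =>
          intro y hy
          refine ih y fun r hr => hf _ fun r' hr' => ?_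
          rw [mul_assoc, ← map_mul]
          exact hy _ (by rw [pow_succ]; exact Ideal.mul_mem_mul hr hr')
      refine hs (hP.1.2 ((hI s).2 (pow n _ fun r hr => ?_)))
      have := (hI _).1 (hn r hr)
      rwa [map_mul, mul_comm (algebraMap R K r), ← mul_assoc] at this
    rcases (polyContent_mul_le_iff f g P).1
      (le_trans (fun r hr => (hI r).2 (hx r hr)) hP.1.2) with h | h
    · exact aux f hf.2 h
    · exact aux g hg.2 h

theorem unitContent_le : unitContent σ R ≤ (MvPolynomial σ R)⁰ := by
  intro f hf
  refine mem_nonZeroDivisors_of_ne_zero fun h => ?_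
  have : polyContent f = ⊤ := hf
  simp [h, polyContent] at this

theorem unitVContent_le : unitVContent σ R K ≤ (MvPolynomial σ R)⁰ := by
  intro f hf
  refine mem_nonZeroDivisors_of_ne_zero fun h => ?_
  have : vClosure (polyContent f : FractionalIdeal R⁰ K) = 1 := hf
  simp [h, polyContent, vClosure, FractionalIdeal.inv_zero'] at this

end Content

section Rings

variable (σ R K L : Type*) [CommRing R] [IsDomain R] [Field K] [Algebra R K] [IsFractionRing R K]
  [Field L] [Algebra (MvPolynomial σ R) L] [IsFractionRing (MvPolynomial σ R) L]

/-- The ring `R({X_α})`, the ring of fractions of `R[{X_α}]` with respect to the polynomials of unit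
content, inside the quotient field `L` of `R[{X_α}]`. -/
noncomputable abbrev unitContentRing : Subalgebra (MvPolynomial σ R) L :=
  Localization.subalgebra.ofField L (unitContent σ R) unitContent_le

/-- The ring `R⟨{X_α}⟩`, the ring of fractions of `R[{X_α}]` with respect to the polynomials `f` with
`c(f)_v = R`, inside the quotient field `L` of `R[{X_α}]` (`K` is the quotient field of `R`). -/
noncomputable abbrev unitVContentRing : Subalgebra (MvPolynomial σ R) L :=
  Localization.subalgebra.ofField L (unitVContent σ R K) (unitVContent_le K)

end Rings

/-!
Write `A = R[X]` for the polynomial ring in the given indeterminates, `L` for its quotient field and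
`S` for the set of polynomials of unit `v`-content. The three rings are the localizations `A_T` of
`A` at `T = 1`, at the polynomials of unit content and at `S`. They are treated uniformly: for every
submonoid `T ≤ S`, the ring `A_T` is a `t#`-domain if and only if for each maximal `t`-ideal `M` of
`R` some `x ∈ L` lies outside `A_{M[X]}` but inside `A_{M'[X]}` for all maximal `t`-ideals `M' ≠ M`
of `R`. This condition does not mention `T`
(`IsExtendedTSharp`, `isTSharpDomain_iff_isExtendedTSharp`).

Maximal `t`-ideals are handled as the ideals maximal among those containing no Glaz–Vasconcelos
ideal, that is, no finitely generated `J` with `J⁻¹ = A` (`mem_tMax_iff`). A domain is a `t#`-domain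
exactly if each maximal `t`-ideal `M` is separated from all the others by a single element, outside
the localization at `M` and inside the other ones (`isTSharpDomain_iff`).

The maximal `t`-ideals of `A_T` contract either to `M[X]`, where every maximal `t`-ideal `M` of `R`
occurs, or to primes `Q` that meet `S`. The latter are uppers to zero `Q = p K[X] ∩ A` with `p`
prime in `K[X]`: if `g ∈ Q ∩ S`, then `g` together with a nonzero constant, or with two polynomials
that are coprime over `K`, generates a Glaz–Vasconcelos ideal. The reason is Gauss's lemma
`g K[X] ∩ A = g A` for `g ∈ S` (`exists_map_eq_of_mul_mem`), a consequence of McCoy's theorem in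
several variables. Such a `Q` is always separated from the others, by an element `e / p` with
`e ∈ R`. An element `x` separating `M[X]` from the other extended ideals can be multiplied by some
`g ∈ S`, a unit at all the extended ideals, that clears the denominator of `x` at all the uppers to
zero (`exists_mul_mem_localizationAt`).

An element of `K` separating `M` in `R` also separates `M[X]` in `A`. Conversely, if `A` is
`v`-coherent, then `(A : x) = I_v` with `I` finitely generated, and the coefficients of `I` generate
a finitely generated ideal `D` of `R` lying in `M` and in no other maximal `t`-ideal. As `D ⊆ M` is
not Glaz–Vasconcelos, some `y ∈ K \ R` has `y D ⊆ R`, and `y` separates `M`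
(`isTSharpDomain_of_isExtendedTSharp`).
-/

/-! ### Glaz–Vasconcelos ideals and maximal `t`-ideals -/

section GlazVasconcelos

variable {A : Type*} (K : Type*) [CommRing A] [Field K] [Algebra A K]

/-- A Glaz–Vasconcelos ideal: a finitely generated ideal `J` with `J⁻¹ = A`, that is, every `x : K`
with `x J ⊆ A` lies in `A`. (If `A` is a field, the zero ideal qualifies.) -/
def IsGV (J : Ideal A) : Prop :=
  J.FG ∧ ∀ x : K, (∀ r ∈ J, x * algebraMap A K r ∈ (algebraMap A K).range) →
    x ∈ (algebraMap A K).range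

/-- An ideal containing no Glaz–Vasconcelos ideal, that is, an ideal with proper `t`-closure. -/
def IsGVFree (I : Ideal A) : Prop :=
  ∀ J ≤ I, ¬ IsGV K J

/-- The `t`-closure of an ideal `I`, as an ideal of `A`. The zero ideal is allowed among the
finitely generated `J ≤ I`; this changes nothing if `I ≠ ⊥`. -/
def tHull (I : Ideal A) : Ideal A where
  carrier := {a | ∃ J : Ideal A, J.FG ∧ J ≤ I ∧
    ∀ x : K, (∀ r ∈ J, x * algebraMap A K r ∈ (algebraMap A K).range) →
      x * algebraMap A K a ∈ (algebraMap A K).range}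
  zero_mem' := ⟨⊥, Submodule.fg_bot, bot_le, fun x _ => by simp⟩
  add_mem' := by
    rintro a b ⟨J, hJ, hJI, ha⟩ ⟨J', hJ', hJI', hb⟩
    refine ⟨J ⊔ J', Submodule.FG.sup hJ hJ', sup_le hJI hJI', fun x hx => ?_⟩
    rw [map_add, mul_add]
    exact add_mem (ha x fun r hr => hx r (Ideal.mem_sup_left hr))
      (hb x fun r hr => hx r (Ideal.mem_sup_right hr))
  smul_mem' := by
    rintro c a ⟨J, hJ, hJI, ha⟩
    refine ⟨J, hJ, hJI, fun x hx => ?_⟩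
    rw [smul_eq_mul, map_mul, mul_left_comm]
    exact mul_mem ⟨c, rfl⟩ (ha x hx)

variable {K}

theorem mem_tHull {I : Ideal A} {a : A} : a ∈ tHull K I ↔ ∃ J : Ideal A, J.FG ∧ J ≤ I ∧
    ∀ x : K, (∀ r ∈ J, x * algebraMap A K r ∈ (algebraMap A K).range) →
      x * algebraMap A K a ∈ (algebraMap A K).range :=
  Iff.rfl

theorem le_tHull (I : Ideal A) : I ≤ tHull K I := fun a ha =>
  ⟨Ideal.span {a}, Submodule.fg_span_singleton a, (Ideal.span_singleton_le_iff_mem _).2 ha,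
    fun _ hx => hx a (Ideal.mem_span_singleton_self a)⟩

theorem tHull_tHull (I : Ideal A) : tHull K (tHull K I) = tHull K I := by
  refine le_antisymm ?_ (le_tHull _)
  rintro a ⟨J, hJ, hJI, ha⟩
  have key : ∀ s : Finset A, (s : Set A) ⊆ tHull K I → ∃ J' : Ideal A, J'.FG ∧ J' ≤ I ∧
      ∀ x : K, (∀ r ∈ J', x * algebraMap A K r ∈ (algebraMap A K).range) →
        ∀ r ∈ Ideal.span (s : Set A), x * algebraMap A K r ∈ (algebraMap A K).range := by
    classical
    intro s
    induction s using Finset.induction_on with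
    | empty =>
      intro _
      refine ⟨⊥, Submodule.fg_bot, bot_le, fun x _ r hr => ?_⟩
      have : r = 0 := by simpa using hr
      simp [this]
    | insert b s _ ih =>
      intro hs
      rw [Finset.coe_insert, Set.insert_subset_iff] at hs
      obtain ⟨J₁, h₁, h₁', h₁''⟩ := ih hs.2
      obtain ⟨J₂, h₂, h₂', h₂''⟩ := hs.1
      refine ⟨J₁ ⊔ J₂, Submodule.FG.sup h₁ h₂, sup_le h₁' h₂', fun x hx r hr => ?_⟩
      rw [Finset.coe_insert, Ideal.span_insert] at hr
      obtain ⟨u, hu, v, hv, rfl⟩ := Submodule.mem_sup.1 hr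
      obtain ⟨c, rfl⟩ := Ideal.mem_span_singleton'.1 hu
      rw [map_add, mul_add, map_mul, mul_left_comm]
      exact add_mem (mul_mem ⟨c, rfl⟩ (h₂'' x fun r hr => hx r (Ideal.mem_sup_right hr)))
        (h₁'' x (fun r hr => hx r (Ideal.mem_sup_left hr)) v hv)
  obtain ⟨s, rfl⟩ := hJ
  obtain ⟨J', h, h', h''⟩ := key s (Ideal.span_le.1 hJI)
  exact ⟨J', h, h', fun x hx => ha x (h'' x hx)⟩

theorem isGVFree_iff_tHull_ne_top {I : Ideal A} : IsGVFree K I ↔ tHull K I ≠ ⊤ := by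
  rw [Ideal.ne_top_iff_one, mem_tHull, IsGVFree]
  simp only [IsGV, map_one, mul_one]
  constructor
  · rintro h ⟨J, hJ, hJI, h1⟩
    exact h J hJI ⟨hJ, h1⟩
  · rintro h J hJI ⟨hJ, h1⟩
    exact h ⟨J, hJ, hJI, h1⟩

theorem isGV_top : IsGV K (⊤ : Ideal A) :=
  ⟨Ideal.fg_top A, fun x hx => by simpa using hx 1 trivial⟩

theorem IsGVFree.ne_top {I : Ideal A} (h : IsGVFree K I) : I ≠ ⊤ := by
  rintro rfl
  exact h ⊤ le_rfl isGV_top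

theorem IsGV.mul {I J : Ideal A} (hI : IsGV K I) (hJ : IsGV K J) : IsGV K (I * J) := by
  refine ⟨hI.1.mul hJ.1, fun x hx => hI.2 x fun r hr => hJ.2 _ fun s hs => ?_⟩
  rw [mul_assoc, ← map_mul]
  exact hx _ (Ideal.mul_mem_mul hr hs)

theorem IsGV.mono {I J : Ideal A} (hI : IsGV K I) (hIJ : I ≤ J) (hJ : J.FG) : IsGV K J :=
  ⟨hJ, fun x hx => hI.2 x fun r hr => hx r (hIJ hr)⟩

theorem isGVFree_of_forall_mul_mem {I : Ideal A} {x : K} (hx : x ∉ (algebraMap A K).range)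
    (h : ∀ r ∈ I, x * algebraMap A K r ∈ (algebraMap A K).range) : IsGVFree K I :=
  fun _ hJI hJ => hx (hJ.2 x fun r hr => h r (hJI hr))

theorem IsGVFree.exists_le_maximal {I : Ideal A} (hI : IsGVFree K I) :
    ∃ M, I ≤ M ∧ Maximal (IsGVFree K) M := by
  refine zorn_le_nonempty₀ {I : Ideal A | IsGVFree K I} (fun c hc hchain J₀ hJ₀ => ?_) I hI
  refine ⟨sSup c, fun J hJ hGV => ?_, fun J => le_sSup⟩
  have hne : c.Nonempty := ⟨J₀, hJ₀⟩
  obtain ⟨M, hM, hJM⟩ : ∃ M ∈ c, J ≤ M :=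
    (CompleteLattice.isCompactElement_iff_le_of_directed_sSup_le _ J).1
      ((Submodule.fg_iff_compact J).1 hGV.1) c hne hchain.directedOn hJ
  exact hc hM J hJM hGV

theorem isPrime_of_maximal_isGVFree {M : Ideal A} (hM : Maximal (IsGVFree K) M) : M.IsPrime := by
  refine ⟨hM.prop.ne_top, fun {a b} hab => ?_⟩
  by_contra! h
  have key : ∀ a ∉ M, ∃ J ≤ M ⊔ Ideal.span {a}, IsGV K J := by
    intro a ha
    by_contra! hfree
    exact ha (hM.le_of_ge hfree le_sup_left
      (Ideal.mem_sup_right (Ideal.mem_span_singleton_self a)))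
  obtain ⟨J, hJ, hJGV⟩ := key a h.1
  obtain ⟨J', hJ', hJGV'⟩ := key b h.2
  refine hM.prop _ ((Ideal.mul_mono hJ hJ').trans ?_) (hJGV.mul hJGV')
  rw [Ideal.sup_mul, Ideal.mul_sup (Ideal.span {a}), Ideal.span_singleton_mul_span_singleton]
  refine sup_le Ideal.mul_le_left ?_
  exact sup_le Ideal.mul_le_right ((Ideal.span_singleton_le_iff_mem _).2 hab)

variable [IsDomain A] [IsFractionRing A K]

theorem mem_vClosure_coeIdeal {J : Ideal A} (hJ : J ≠ ⊥) {y : K} :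
    y ∈ vClosure (J : FractionalIdeal A⁰ K) ↔
      ∀ x : K, (∀ r ∈ J, x * algebraMap A K r ∈ (algebraMap A K).range) →
        x * y ∈ (algebraMap A K).range := by
  have h0 : (J : FractionalIdeal A⁰ K) ≠ 0 := FractionalIdeal.coeIdeal_ne_zero.2 hJ
  have key : ∀ x : K, x ∈ (J : FractionalIdeal A⁰ K)⁻¹ ↔
      ∀ r ∈ J, x * algebraMap A K r ∈ (algebraMap A K).range := by
    intro x
    rw [FractionalIdeal.mem_inv_iff h0]
    constructor
    · intro h r hr
      exact (FractionalIdeal.mem_one_iff _).1 (h _ (FractionalIdeal.mem_coeIdeal_of_mem _ hr))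
    · intro h z hz
      obtain ⟨r, hr, rfl⟩ := (FractionalIdeal.mem_coeIdeal _).1 hz
      exact (FractionalIdeal.mem_one_iff _).2 (h r hr)
  have h1 : (J : FractionalIdeal A⁰ K)⁻¹ ≠ 0 := by
    intro h
    have : (1 : K) ∈ (J : FractionalIdeal A⁰ K)⁻¹ := (key 1).2 fun r _ => ⟨r, by simp⟩
    rw [h] at this
    exact one_ne_zero ((FractionalIdeal.mem_zero_iff _).1 this)
  rw [vClosure, FractionalIdeal.mem_inv_iff h1]
  constructor
  · intro h x hx
    rw [mul_comm]
    exact (FractionalIdeal.mem_one_iff _).1 (h x ((key x).2 hx))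
  · intro h x hx
    rw [mul_comm]
    exact (FractionalIdeal.mem_one_iff _).2 (h x ((key x).1 hx))

theorem tClosure_coeIdeal {I : Ideal A} (hI : I ≠ ⊥) :
    tClosure (I : FractionalIdeal A⁰ K) = algebraMap A K '' (tHull K I) := by
  have hinj := IsFractionRing.injective A K
  ext y
  constructor
  · rintro ⟨J, hJ0, hJ, hJI, hy⟩
    obtain ⟨J, rfl⟩ := FractionalIdeal.le_one_iff_exists_coeIdeal.1
      (hJI.trans FractionalIdeal.coeIdeal_le_one)
    rw [mem_vClosure_coeIdeal (FractionalIdeal.coeIdeal_ne_zero.1 hJ0)] at hy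
    obtain ⟨a, ha⟩ := hy 1 fun r _ => ⟨r, by simp⟩
    rw [one_mul] at ha
    subst ha
    refine ⟨a, ⟨J, ?_, FractionalIdeal.coeIdeal_le_coeIdeal K |>.1 hJI, hy⟩, rfl⟩
    rw [FractionalIdeal.coe_coeIdeal] at hJ
    exact (IsLocalization.coeSubmodule_fg K hinj J).1 hJ
  · rintro ⟨a, ⟨J, hJ, hJI, ha⟩, rfl⟩
    obtain ⟨b, hb, hb0⟩ := Submodule.exists_mem_ne_zero_of_ne_bot hI
    have hne : J ⊔ Ideal.span {b} ≠ ⊥ := fun h =>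
      hb0 ((Submodule.eq_bot_iff _).1 h b
        (Ideal.mem_sup_right (Ideal.mem_span_singleton_self b)))
    refine ⟨(J ⊔ Ideal.span {b} : Ideal A), FractionalIdeal.coeIdeal_ne_zero.2 hne, ?_,
      (FractionalIdeal.coeIdeal_le_coeIdeal K).2
        (sup_le hJI ((Ideal.span_singleton_le_iff_mem _).2 hb)),
      (mem_vClosure_coeIdeal hne).2 fun x hx => ha x fun r hr => hx r (Ideal.mem_sup_left hr)⟩
    rw [FractionalIdeal.coe_coeIdeal]
    exact (IsLocalization.coeSubmodule_fg K hinj _).2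
      (Submodule.FG.sup hJ (Submodule.fg_span_singleton b))

theorem isTIdeal_iff {I : Ideal A} : IsTIdeal K I ↔ I ≠ ⊥ ∧ tHull K I = I := by
  refine and_congr_right fun hI => ?_
  have hset : {x : K | x ∈ (I : FractionalIdeal A⁰ K)} = algebraMap A K '' I := by
    ext x
    exact FractionalIdeal.mem_coeIdeal _
  rw [tClosure_coeIdeal hI, hset, (IsFractionRing.injective A K).image_injective.eq_iff,
    SetLike.coe_set_eq]

theorem ne_bot_of_mem_tMax {M : Ideal A} (hM : M ∈ tMax A K) : M ≠ ⊥ := by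
  have hM : Maximal (fun I : Ideal A => I ≠ ⊤ ∧ IsTIdeal K I) M := hM
  exact hM.prop.2.1

/-- The maximal `t`-ideals are the ideals maximal among those without Glaz–Vasconcelos subideals. -/
theorem mem_tMax_iff {M : Ideal A} : M ∈ tMax A K ↔ Maximal (IsGVFree K) M := by
  have hfree : ∀ {I : Ideal A}, I ≠ ⊤ → IsTIdeal K I → IsGVFree K I := by
    intro I htop hI
    rwa [isGVFree_iff_tHull_ne_top, (isTIdeal_iff.1 hI).2]
  constructor
  · intro (hM : Maximal (fun I : Ideal A => I ≠ ⊤ ∧ IsTIdeal K I) M)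
    refine ⟨hfree hM.prop.1 hM.prop.2, fun I hI hMI => ?_⟩
    refine (le_tHull I).trans (hM.le_of_ge ⟨isGVFree_iff_tHull_ne_top.1 hI,
      isTIdeal_iff.2 ⟨fun h => (isTIdeal_iff.1 hM.prop.2).1 ?_, tHull_tHull I⟩⟩
      (hMI.trans (le_tHull I)))
    exact le_bot_iff.1 (h ▸ hMI.trans (le_tHull I))
  · intro hM
    have h0 : M ≠ ⊥ := by
      -- `⊥` is free only if `A ≠ K`, and then a nonzero nonunit generates a larger free ideal.
      rintro rfl
      obtain ⟨x, hx⟩ : ∃ x : K, x ∉ (algebraMap A K).range := by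
        by_contra! h
        exact hM.prop ⊥ le_rfl ⟨Submodule.fg_bot, fun x _ => h x⟩
      obtain ⟨a, b, hb, rfl⟩ := IsFractionRing.div_surjective A x
      have hb0 : algebraMap A K b ≠ 0 := by
        simpa using nonZeroDivisors.ne_zero hb
      have hbI : IsGVFree K (Ideal.span {b}) := by
        refine isGVFree_of_forall_mul_mem hx fun r hr => ?_
        obtain ⟨c, rfl⟩ := Ideal.mem_span_singleton'.1 hr
        exact ⟨a * c, by rw [map_mul, map_mul]; field_simp⟩
      exact nonZeroDivisors.ne_zero hb
        ((Submodule.mem_bot A).1 (hM.le_of_ge hbI bot_le (Ideal.mem_span_singleton_self b)))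
    have hMt : tHull K M = M := by
      refine le_antisymm (hM.le_of_ge ?_ (le_tHull M)) (le_tHull M)
      rw [isGVFree_iff_tHull_ne_top, tHull_tHull]
      exact isGVFree_iff_tHull_ne_top.1 hM.prop
    exact ⟨⟨hM.prop.ne_top, isTIdeal_iff.2 ⟨h0, hMt⟩⟩,
      fun I hI hMI => hM.le_of_ge (hfree hI.1 hI.2) hMI⟩

/-- An element of `K` lying in `A_M` for all maximal `t`-ideals `M` lies in `A`. -/
theorem mem_range_of_forall_mem_localizationAt {x : K}
    (h : ∀ M ∈ tMax A K, x ∈ localizationAt K M) : x ∈ (algebraMap A K).range := by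
  by_contra hx
  let I : Ideal A :=
    { carrier := {r | x * algebraMap A K r ∈ (algebraMap A K).range}
      zero_mem' := by simp
      add_mem' := by
        intro a b ha hb
        change x * algebraMap A K (a + b) ∈ (algebraMap A K).range
        rw [map_add, mul_add]
        exact add_mem ha hb
      smul_mem' := by
        intro c a ha
        change x * algebraMap A K (c * a) ∈ (algebraMap A K).range
        rw [map_mul, mul_left_comm]
        exact mul_mem ⟨c, rfl⟩ ha }
  have hI : IsGVFree K I := isGVFree_of_forall_mul_mem hx fun r hr => hr
  obtain ⟨M, hIM, hM⟩ := hI.exists_le_maximal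
  obtain ⟨a, s, hs, rfl⟩ := h M (mem_tMax_iff.2 hM)
  have hs0 : algebraMap A K s ≠ 0 := by
    intro h0
    exact hs (by rw [(FaithfulSMul.algebraMap_eq_zero_iff A K).1 h0]; exact M.zero_mem)
  exact hs (hIM ⟨a, by field_simp⟩)

theorem isTSharpDomain_iff : IsTSharpDomain A K ↔ ∀ M ∈ tMax A K, ∃ x : K,
    x ∉ localizationAt K M ∧ ∀ N ∈ tMax A K, N ≠ M → x ∈ localizationAt K N := by
  constructor
  · intro h M hM
    by_contra! hx
    refine h (tMax A K) (tMax A K \ {M}) subset_rfl Set.sdiff_subset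
      (fun h => (h ▸ hM : M ∈ tMax A K \ {M}).2 rfl) (Set.Subset.antisymm ?_ ?_)
    · exact Set.biInter_subset_biInter_left Set.sdiff_subset
    · intro x hx'
      rw [Set.mem_iInter₂] at hx' ⊢
      intro N hN
      by_cases hNM : N = M
      · subst hNM
        by_contra hxN
        obtain ⟨N', hN', hne, hN''⟩ := hx x hxN
        exact hN'' (hx' N' ⟨hN', hne⟩)
      · exact hx' N ⟨hN, hNM⟩
  · have key : (∀ M ∈ tMax A K, ∃ x : K,
        x ∉ localizationAt K M ∧ ∀ N ∈ tMax A K, N ≠ M → x ∈ localizationAt K N) →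
        ∀ 𝓜₁ 𝓜₂ : Set (Ideal A), 𝓜₁ ⊆ tMax A K → 𝓜₂ ⊆ tMax A K →
        ⋂ M ∈ 𝓜₂, localizationAt K M ⊆ ⋂ M ∈ 𝓜₁, localizationAt K M → 𝓜₁ ⊆ 𝓜₂ := by
      intro h 𝓜₁ 𝓜₂ h₁ h₂ hle M hM
      by_contra hM₂
      obtain ⟨x, hx, hx'⟩ := h M (h₁ hM)
      refine hx (Set.mem_iInter₂.1 (hle (Set.mem_iInter₂.2 fun N hN => hx' N (h₂ hN) ?_)) M hM)
      rintro rfl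
      exact hM₂ hN
    intro h 𝓜₁ 𝓜₂ h₁ h₂ hne heq
    exact hne (Set.Subset.antisymm (key h _ _ h₁ h₂ heq.ge) (key h _ _ h₂ h₁ heq.le))

end GlazVasconcelos

/-! ### McCoy's theorem, contents and Gauss's lemma -/

section McCoy

variable {R σ : Type*} [CommRing R]

theorem nonempty_monomialOrder.{u} (σ : Type u) : Nonempty (MonomialOrder.{u, u} σ) := by
  obtain ⟨o, ho⟩ := exists_wellFoundedLT σ
  let _ : LinearOrder σ := inferInstanceAs (LinearOrder σᵒᵈ)
  have : WellFoundedGT σ := ⟨ho.wf⟩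
  exact ⟨MonomialOrder.lex⟩

/-- McCoy's theorem: a polynomial that is a zero divisor is annihilated by a nonzero constant. -/
theorem MvPolynomial.exists_forall_mul_coeff_eq_zero {f g : MvPolynomial σ R} (hfg : f * g = 0)
    (hg : g ≠ 0) : ∃ r : R, r ≠ 0 ∧ ∀ d, r * f.coeff d = 0 := by
  classical
  obtain ⟨m⟩ := nonempty_monomialOrder σ
  induction hn : g.support.card using Nat.strong_induction_on generalizing g with
  | _ n ih =>
  by_cases hall : ∀ d, C (f.coeff d) * g = 0
  · refine ⟨m.leadingCoeff g, m.leadingCoeff_ne_zero_iff.2 hg, fun d => ?_⟩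
    have := congrArg (coeff (m.degree g)) (hall d)
    rwa [coeff_C_mul, coeff_zero, mul_comm] at this
  · -- Drop from `f` the terms annihilating `g`. The leading coefficient of the remaining
    -- polynomial kills that of `g`, so multiplying `g` by it gives an annihilator with fewer terms.
    push Not at hall
    obtain ⟨d₀, hd₀⟩ := hall
    let T := f.support.filter fun d => C (f.coeff d) * g ≠ 0
    let f' : MvPolynomial σ R := ∑ d ∈ T, monomial d (f.coeff d)
    have hcoeff : ∀ d, f'.coeff d = if d ∈ T then f.coeff d else 0 := by
      intro d
      simp only [f', coeff_sum, coeff_monomial, Finset.sum_ite_eq']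
    have hf'g : f' * g = 0 := by
      have hsplit : f = f' + ∑ d ∈ f.support.filter (fun d => ¬ C (f.coeff d) * g ≠ 0),
          monomial d (f.coeff d) := by
        rw [Finset.sum_filter_add_sum_filter_not, ← as_sum]
      have hzero : (∑ d ∈ f.support.filter (fun d => ¬ C (f.coeff d) * g ≠ 0),
          monomial d (f.coeff d)) * g = 0 := by
        rw [Finset.sum_mul]
        refine Finset.sum_eq_zero fun d hd => ?_
        have h0 := not_not.1 (Finset.mem_filter.1 hd).2
        rw [show monomial d (f.coeff d) = monomial d 1 * C (f.coeff d) by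
          rw [mul_comm, C_mul_monomial, mul_one], mul_assoc, h0, mul_zero]
      rw [hsplit, add_mul, hzero, add_zero] at hfg
      exact hfg
    have hd₀T : d₀ ∈ T := by
      refine Finset.mem_filter.2 ⟨mem_support_iff.2 fun h => hd₀ (by rw [h]; simp), hd₀⟩
    have hf'0 : f' ≠ 0 := by
      intro h
      have := hcoeff d₀
      rw [h, coeff_zero, if_pos hd₀T] at this
      exact hd₀ (by rw [← this]; simp)
    have hlead : m.leadingCoeff f' * m.leadingCoeff g = 0 := by
      rw [← m.coeff_mul_of_degree_add, hf'g, coeff_zero]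
    have hdeg : m.degree f' ∈ T := by
      by_contra h
      exact m.leadingCoeff_ne_zero_iff.2 hf'0 ((hcoeff _).trans (if_neg h))
    have hlc : m.leadingCoeff f' = f.coeff (m.degree f') := (hcoeff _).trans (if_pos hdeg)
    have hne : C (m.leadingCoeff f') * g ≠ 0 := by
      rw [hlc]
      exact (Finset.mem_filter.1 hdeg).2
    refine ih _ ?_ (g := C (m.leadingCoeff f') * g) ?_ hne rfl
    · rw [← hn]
      refine Finset.card_lt_card (Finset.ssubset_iff_subset_ne.2 ⟨fun d hd => ?_, fun h => ?_⟩)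
      · rw [mem_support_iff, coeff_C_mul] at hd
        exact mem_support_iff.2 (right_ne_zero_of_mul hd)
      · have : m.degree g ∈ (C (m.leadingCoeff f') * g).support := by
          rw [h]
          exact m.degree_mem_support hg
        rw [mem_support_iff, coeff_C_mul] at this
        exact this hlead
    · rw [mul_left_comm, hfg, mul_zero]

end McCoy

section Coefficients

variable {R σ : Type*} [CommRing R]

theorem coeff_mem_polyContent (f : MvPolynomial σ R) (d : σ →₀ ℕ) : f.coeff d ∈ polyContent f := by
  by_cases h : f.coeff d = 0
  · rw [h]
    exact Ideal.zero_mem _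
  · exact Ideal.subset_span (MvPolynomial.coeff_mem_coeffs d h)

theorem polyContent_le {f : MvPolynomial σ R} {I : Ideal R} :
    polyContent f ≤ I ↔ ∀ d, f.coeff d ∈ I := by
  refine ⟨fun h d => h (coeff_mem_polyContent f d), fun h => Ideal.span_le.2 fun c hc => ?_⟩
  obtain ⟨d, -, rfl⟩ := MvPolynomial.mem_coeffs_iff.1 hc
  exact h d

theorem polyContent_le_iff_mem_map {f : MvPolynomial σ R} {I : Ideal R} :
    polyContent f ≤ I ↔ f ∈ I.map (MvPolynomial.C : R →+* MvPolynomial σ R) := by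
  rw [polyContent_le, MvPolynomial.mem_map_C_iff]

theorem polyContent_fg (f : MvPolynomial σ R) : (polyContent f).FG := ⟨f.coeffs, rfl⟩

/-- The ideal generated by the coefficients of the elements of an ideal `Q` of polynomials. -/
def coeffIdeal (Q : Ideal (MvPolynomial σ R)) : Ideal R :=
  ⨆ f ∈ Q, polyContent f

theorem polyContent_le_coeffIdeal {Q : Ideal (MvPolynomial σ R)} {f : MvPolynomial σ R}
    (hf : f ∈ Q) : polyContent f ≤ coeffIdeal Q :=
  le_iSup₂_of_le f hf le_rfl

theorem coeffIdeal_le_iff {Q : Ideal (MvPolynomial σ R)} {I : Ideal R} :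
    coeffIdeal Q ≤ I ↔ Q ≤ I.map (MvPolynomial.C : R →+* MvPolynomial σ R) := by
  simp only [coeffIdeal, iSup₂_le_iff, polyContent_le_iff_mem_map]
  rfl

theorem coeffIdeal_fg {Q : Ideal (MvPolynomial σ R)} (hQ : Q.FG) : (coeffIdeal Q).FG := by
  classical
  obtain ⟨s, rfl⟩ := hQ
  have : coeffIdeal (Ideal.span (s : Set (MvPolynomial σ R))) = s.sup polyContent := by
    refine le_antisymm (coeffIdeal_le_iff.2 (Ideal.span_le.2 fun f hf => ?_))
      (Finset.sup_le fun f hf => polyContent_le_coeffIdeal (Ideal.subset_span hf))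
    exact polyContent_le_iff_mem_map.1 (Finset.le_sup (f := polyContent) hf)
  rw [this]
  exact Submodule.fg_finset_sup s _ fun f _ => polyContent_fg f

/-- In at least one variable, shifting `g` by a high power of a variable separates its terms from
those of `f`. -/
theorem exists_polyContent_sup_le [Nonempty σ] (f g : MvPolynomial σ R) :
    ∃ u : MvPolynomial σ R, polyContent f ⊔ polyContent g ≤ polyContent (f + u * g) := by
  classical
  obtain ⟨i⟩ := ‹Nonempty σ›
  let e : σ →₀ ℕ := Finsupp.single i (f.degreeOf i + 1)
  have hf : ∀ d, f.coeff (e + d) = 0 := by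
    intro d
    by_contra h
    have := MvPolynomial.le_degreeOf_of_mem_support (i := i) (MvPolynomial.mem_support_iff.2 h)
    simp [e] at this
    omega
  have hg : ∀ d, (f + MvPolynomial.monomial e 1 * g).coeff (e + d) = g.coeff d := by
    intro d
    rw [MvPolynomial.coeff_add, MvPolynomial.coeff_monomial_mul, hf, zero_add, one_mul]
  refine ⟨MvPolynomial.monomial e 1, sup_le (polyContent_le.2 fun d => ?_)
    (polyContent_le.2 fun d => ?_)⟩
  · by_cases hd : e ≤ d
    · obtain ⟨d, rfl⟩ := exists_add_of_le hd
      rw [hf]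
      exact Ideal.zero_mem _
    · have := coeff_mem_polyContent (f + MvPolynomial.monomial e 1 * g) d
      rwa [MvPolynomial.coeff_add, MvPolynomial.coeff_monomial_mul', if_neg hd, add_zero] at this
  · rw [← hg d]
    exact coeff_mem_polyContent _ _

theorem exists_le_polyContent [Nonempty σ] {Q : Ideal (MvPolynomial σ R)} {J : Ideal R}
    (hJ : J.FG) (hJQ : J ≤ coeffIdeal Q) : ∃ f ∈ Q, J ≤ polyContent f := by
  have hdir : DirectedOn (· ≤ ·) (polyContent '' (Q : Set (MvPolynomial σ R))) := by
    rintro _ ⟨f, hf, rfl⟩ _ ⟨g, hg, rfl⟩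
    obtain ⟨u, hu⟩ := exists_polyContent_sup_le f g
    exact ⟨_, Set.mem_image_of_mem _ (Q.add_mem hf (Q.mul_mem_left u hg)),
      le_sup_left.trans hu, le_sup_right.trans hu⟩
  obtain ⟨_, ⟨f, hf, rfl⟩, h⟩ :=
    (CompleteLattice.isCompactElement_iff_le_of_directed_sSup_le _ J).1
      ((Submodule.fg_iff_compact J).1 hJ) (polyContent '' (Q : Set (MvPolynomial σ R)))
      ⟨_, 0, Q.zero_mem, rfl⟩ hdir
      (by rwa [sSup_image])
  exact ⟨f, hf, h⟩

end Coefficients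

section Gauss

variable {R σ : Type*} [CommRing R] [IsDomain R] {K : Type*} [Field K] [Algebra R K]
  [IsFractionRing R K]

theorem isGV_polyContent_of_mem {g : MvPolynomial σ R} (hg : g ∈ unitVContent σ R K) :
    IsGV K (polyContent g) := by
  refine ⟨polyContent_fg g, fun x hx => (FractionalIdeal.mem_one_iff _).1
    (((vClosure_polyContent_eq_one_iff K g).1 hg).2 x fun r hr => ?_)⟩
  exact (FractionalIdeal.mem_one_iff _).2 (hx r hr)

theorem mem_unitVContent_of_isGV {g : MvPolynomial σ R} (hg : IsGV K (polyContent g))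
    (h0 : polyContent g ≠ ⊥) : g ∈ unitVContent σ R K :=
  (vClosure_polyContent_eq_one_iff K g).2 ⟨h0, fun x hx => (FractionalIdeal.mem_one_iff _).2
    (hg.2 x fun r hr => (FractionalIdeal.mem_one_iff _).1 (hx r hr))⟩

theorem unitContent_le_unitVContent : unitContent σ R ≤ unitVContent σ R K := by
  intro f hf
  have hf : polyContent f = ⊤ := hf
  refine mem_unitVContent_of_isGV ?_ ?_
  · rw [hf]
    exact isGV_top
  · rw [hf]
    exact top_ne_bot

theorem exists_C_mul_eq_map (h : MvPolynomial σ K) : ∃ e : R, e ≠ 0 ∧ ∃ f : MvPolynomial σ R,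
    MvPolynomial.map (algebraMap R K) f = MvPolynomial.C (algebraMap R K e) * h := by
  let _ := MvPolynomial.algebraMvPolynomial (σ := σ) (R := R) (S := K)
  have : IsLocalization (R⁰.map (MvPolynomial.C (σ := σ))) (MvPolynomial σ K) :=
    MvPolynomial.isLocalization R⁰ K
  obtain ⟨⟨f, ⟨_, e, he, rfl⟩⟩, hf⟩ := IsLocalization.surj (R⁰.map (MvPolynomial.C (σ := σ))) h
  refine ⟨e, nonZeroDivisors.ne_zero he, f, ?_⟩
  rw [MvPolynomial.algebraMap_def, MvPolynomial.map_C, mul_comm] at hf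
  exact hf.symm

/-- A form of Gauss's lemma: for `g` with `c(g)_v = R`, `g K[X] ∩ R[X] = g R[X]`. Clearing the
denominator `s` of `h` makes `g` a zero divisor modulo `s`, unless `s` divides `s h`; by McCoy's
theorem some `r / s ∉ R` then multiplies the coefficients of `g` into `R`. -/
theorem exists_map_eq_of_mul_mem {g : MvPolynomial σ R} (hg : g ∈ unitVContent σ R K)
    {h : MvPolynomial σ K} {f : MvPolynomial σ R}
    (hf : MvPolynomial.map (algebraMap R K) g * h = MvPolynomial.map (algebraMap R K) f) :
    ∃ h' : MvPolynomial σ R, MvPolynomial.map (algebraMap R K) h' = h := by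
  have hinj : Function.Injective (MvPolynomial.map (σ := σ) (algebraMap R K)) :=
    MvPolynomial.map_injective _ (IsFractionRing.injective R K)
  obtain ⟨s, hs, k, hk⟩ := exists_C_mul_eq_map (R := R) h
  have hsK : algebraMap R K s ≠ 0 := by
    rwa [Ne, FaithfulSMul.algebraMap_eq_zero_iff]
  have hgk : g * k = MvPolynomial.C s * f := by
    apply hinj
    rw [map_mul, map_mul, hk, ← hf, MvPolynomial.map_C]
    ring
  by_cases hk0 : MvPolynomial.map (Ideal.Quotient.mk (Ideal.span {s})) k = 0
  · rw [← polyContent_le_iff, polyContent_le_iff_mem_map, Ideal.map_span,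
      Set.image_singleton, Ideal.mem_span_singleton] at hk0
    obtain ⟨h', rfl⟩ := hk0
    refine ⟨h', ?_⟩
    rw [map_mul, MvPolynomial.map_C] at hk
    exact mul_left_cancel₀ (by simpa using hsK) hk
  · have hz : MvPolynomial.map (Ideal.Quotient.mk (Ideal.span {s})) g *
        MvPolynomial.map (Ideal.Quotient.mk (Ideal.span {s})) k = 0 := by
      rw [← map_mul, hgk, map_mul, MvPolynomial.map_C,
        Ideal.Quotient.eq_zero_iff_mem.2 (Ideal.mem_span_singleton_self s), map_zero, zero_mul]
    obtain ⟨r, hr0, hr⟩ := MvPolynomial.exists_forall_mul_coeff_eq_zero hz hk0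
    obtain ⟨r, rfl⟩ := Ideal.Quotient.mk_surjective r
    have hle : polyContent g ≤ (Ideal.span {s}).colon {r} := by
      refine polyContent_le.2 fun d => ?_
      have := hr d
      rw [MvPolynomial.coeff_map, ← map_mul, Ideal.Quotient.eq_zero_iff_mem] at this
      rw [Submodule.mem_colon_singleton, smul_eq_mul, mul_comm]
      exact this
    obtain ⟨a, ha⟩ := (isGV_polyContent_of_mem hg).2 (algebraMap R K r / algebraMap R K s) (by
      intro c hc
      have := hle hc
      rw [Submodule.mem_colon_singleton, smul_eq_mul] at this
      obtain ⟨b, hb⟩ := Ideal.mem_span_singleton'.1 this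
      refine ⟨b, ?_⟩
      rw [div_mul_eq_mul_div, eq_div_iff hsK, ← map_mul, ← map_mul, hb, mul_comm])
    refine absurd (Ideal.Quotient.eq_zero_iff_mem.2 (Ideal.mem_span_singleton'.2 ⟨a, ?_⟩)) hr0
    apply IsFractionRing.injective R K
    rw [map_mul, ha, div_mul_cancel₀ _ hsK]

end Gauss

/-! ### Divisibility, localization and uppers to zero -/

section Divisibility

variable {A K : Type*} [CommRing A] [Field K] [Algebra A K] [IsFractionRing A K]

theorem div_mul_mem_range_iff {f w r : A} (hw : w ≠ 0) :
    algebraMap A K f / algebraMap A K w * algebraMap A K r ∈ (algebraMap A K).range ↔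
      w ∣ f * r := by
  have hw' : algebraMap A K w ≠ 0 := by rwa [Ne, FaithfulSMul.algebraMap_eq_zero_iff]
  constructor
  · rintro ⟨a, ha⟩
    refine ⟨a, IsFractionRing.injective A K ?_⟩
    rw [map_mul, map_mul, ha]
    field_simp
  · rintro ⟨a, ha⟩
    refine ⟨a, ?_⟩
    rw [div_mul_eq_mul_div, ← map_mul, ha, map_mul, mul_div_cancel_left₀ _ hw']

theorem div_mem_range_iff {f w : A} (hw : w ≠ 0) :
    algebraMap A K f / algebraMap A K w ∈ (algebraMap A K).range ↔ w ∣ f := by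
  simpa using div_mul_mem_range_iff (K := K) (f := f) (r := 1) hw

theorem isGV_iff_dvd [IsDomain A] {J : Ideal A} : IsGV K J ↔ J.FG ∧ ∀ f w : A, w ≠ 0 →
    (∀ r ∈ J, w ∣ f * r) → w ∣ f := by
  refine and_congr_right fun _ => ⟨fun h f w hw hr => ?_, fun h x hx => ?_⟩
  · exact (div_mem_range_iff hw).1 (h _ fun r hrJ => (div_mul_mem_range_iff hw).2 (hr r hrJ))
  · obtain ⟨f, w, hw, rfl⟩ := IsFractionRing.div_surjective A x
    have hw := nonZeroDivisors.ne_zero hw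
    exact (div_mem_range_iff hw).2 (h f w hw fun r hr => (div_mul_mem_range_iff hw).1 (hx r hr))

theorem dvd_of_dvd_mul_of_dvd_mul_prime {A : Type*} [CommRing A] [IsDomain A] {p f w k : A}
    (hp : Prime p) (hpf : ¬ p ∣ f) (hf : w ∣ k * f) (hkp : w ∣ k * p) : w ∣ k := by
  by_cases hw0 : w = 0
  · subst hw0
    rwa [zero_dvd_iff, mul_eq_zero, or_iff_left hp.ne_zero, ← zero_dvd_iff] at hkp
  obtain ⟨v, hv⟩ := hkp
  suffices h : p ∣ v by
    obtain ⟨v, rfl⟩ := h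
    exact ⟨v, mul_right_cancel₀ hp.ne_zero (by rw [hv]; ring)⟩
  refine (hp.dvd_or_dvd ⟨k, by rw [← hv, mul_comm]⟩).elim (fun hpw => ?_) id
  obtain ⟨w, rfl⟩ := hpw
  obtain ⟨u, hu⟩ := hf
  have hk : k = w * v := mul_right_cancel₀ hp.ne_zero (by rw [hv]; ring)
  refine (hp.dvd_or_dvd ⟨u, mul_left_cancel₀ (right_ne_zero_of_mul hw0) ?_⟩).resolve_right hpf
  rw [← mul_assoc, ← hk, hu]
  ring

end Divisibility

section Localization

variable {A : Type*} [CommRing A] {B : Type*} [CommRing B]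
  [Algebra A B] {L : Type*} [Field L] [Algebra A L]
  [Algebra B L] [IsScalarTower A B L]

variable (B) in
theorem algebraMap_ne_zero_of_mem (T : Submonoid A) [IsLocalization T B] {t : A} (ht : t ∈ T) :
    algebraMap A L t ≠ 0 := by
  rw [IsScalarTower.algebraMap_apply A B L]
  exact ((IsLocalization.map_units B ⟨t, ht⟩).map (algebraMap B L)).ne_zero

theorem mul_mem_range_of_mem (T : Submonoid A) [IsLocalization T B] {t : A} (ht : t ∈ T) {x : L}
    (hx : algebraMap A L t * x ∈ (algebraMap A L).range) : x ∈ (algebraMap B L).range := by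
  obtain ⟨a, ha⟩ := hx
  refine ⟨IsLocalization.mk' B a ⟨t, ht⟩, ?_⟩
  refine mul_left_cancel₀ (algebraMap_ne_zero_of_mem B T ht) ?_
  rw [← ha, IsScalarTower.algebraMap_apply A B L, IsScalarTower.algebraMap_apply A B L a,
    ← map_mul, mul_comm]
  exact congrArg _ (IsLocalization.mk'_spec B a ⟨t, ht⟩)

theorem IsGV.map_algebraMap (T : Submonoid A) [IsLocalization T B] {J : Ideal A}
    (hJ : IsGV L J) : IsGV L (J.map (algebraMap A B)) := by
  classical
  refine ⟨hJ.1.map _, fun x hx => ?_⟩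
  obtain ⟨s, hs⟩ := hJ.1
  have hsJ : ∀ r ∈ s, r ∈ J := fun r hr => hs ▸ Ideal.subset_span hr
  choose! c hc using fun r (hr : r ∈ J) => hx _ (Ideal.mem_map_of_mem (algebraMap A B) hr)
  obtain ⟨t, ht⟩ := IsLocalization.exist_integer_multiples T s c
  refine mul_mem_range_of_mem T t.2 (hJ.2 _ fun r hr => ?_)
  rw [← hs] at hr
  induction hr using Submodule.span_induction with
  | mem r hr =>
    obtain ⟨a, ha⟩ := ht r hr
    refine ⟨a, ?_⟩
    rw [IsScalarTower.algebraMap_apply A B L, ha, Algebra.smul_def, map_mul, hc r (hsJ r hr),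
      ← IsScalarTower.algebraMap_apply, ← IsScalarTower.algebraMap_apply, mul_assoc]
  | zero => simp
  | add a b _ _ ha hb =>
    rw [map_add, mul_add]
    exact add_mem ha hb
  | smul a b _ hb =>
    rw [smul_eq_mul, map_mul, mul_left_comm]
    exact mul_mem ⟨a, rfl⟩ hb

theorem IsGVFree.under (T : Submonoid A) [IsLocalization T B] {N : Ideal B}
    (hN : IsGVFree L N) : IsGVFree L (N.under A) :=
  fun _ hJ hGV => hN _ (Ideal.map_le_iff_le_comap.2 hJ) (hGV.map_algebraMap T)

/-- Localizing `B = A_T` at a prime is localizing `A` at the contracted prime. -/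
theorem localizationAt_eq_under [IsDomain A] [IsDomain B] [IsFractionRing A L]
    [IsFractionRing B L] (T : Submonoid A) [IsLocalization T B] {N : Ideal B} (hN : N.IsPrime) :
    localizationAt L N = localizationAt L (N.under A) := by
  have hT : ∀ t : T, algebraMap A B t ∉ N := fun t ht =>
    hN.ne_top (Ideal.eq_top_of_isUnit_mem _ ht (IsLocalization.map_units B t))
  ext x
  constructor
  · rintro ⟨b, c, hc, rfl⟩
    obtain ⟨⟨b', t⟩, hb⟩ := IsLocalization.surj T b
    obtain ⟨⟨c', u⟩, hc'⟩ := IsLocalization.surj T c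
    refine ⟨b' * u, c' * t, fun h => ?_, ?_⟩
    · rw [Ideal.under_def, Ideal.mem_comap, map_mul, ← hc'] at h
      exact (hN.mem_or_mem h).elim (fun h => (hN.mem_or_mem h).elim hc (hT u)) (hT t)
    · have hc0 : algebraMap B L c ≠ 0 := (FaithfulSMul.algebraMap_eq_zero_iff B L).not.2
        fun h => hc (h ▸ N.zero_mem)
      have ht := algebraMap_ne_zero_of_mem B (L := L) T t.2
      have hu := algebraMap_ne_zero_of_mem B (L := L) T u.2
      replace hb := congrArg (algebraMap B L) hb
      replace hc' := congrArg (algebraMap B L) hc'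
      simp only [map_mul, ← IsScalarTower.algebraMap_apply] at hb hc'
      rw [map_mul, map_mul, ← hb, ← hc']
      field_simp
  · rintro ⟨a, s, hs, rfl⟩
    exact ⟨algebraMap A B a, algebraMap A B s, hs, by
      rw [← IsScalarTower.algebraMap_apply, ← IsScalarTower.algebraMap_apply]⟩

end Localization

section TMaxPolynomial

variable {R σ : Type*} [CommRing R]

theorem isPrime_map_C {M : Ideal R} (hM : M.IsPrime) :
    (M.map (MvPolynomial.C : R →+* MvPolynomial σ R)).IsPrime := by
  refine ⟨fun h => hM.ne_top ?_, fun {f g} hfg => ?_⟩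
  · have := (Ideal.eq_top_iff_one _).1 h
    rwa [← polyContent_le_iff_mem_map, polyContent_one, top_le_iff] at this
  · rwa [← polyContent_le_iff_mem_map, polyContent_mul_le_iff, polyContent_le_iff_mem_map,
      polyContent_le_iff_mem_map] at hfg

theorem C_mem_map_C_iff {M : Ideal R} {a : R} :
    (MvPolynomial.C a : MvPolynomial σ R) ∈ M.map (MvPolynomial.C : R →+* MvPolynomial σ R) ↔
      a ∈ M := by
  refine ⟨fun h => ?_, fun h => Ideal.mem_map_of_mem _ h⟩
  simpa using MvPolynomial.mem_map_C_iff.1 h 0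

theorem map_C_le_map_C_iff {M M' : Ideal R} :
    M.map (MvPolynomial.C : R →+* MvPolynomial σ R) ≤ M'.map MvPolynomial.C ↔ M ≤ M' :=
  ⟨fun h _ ha => C_mem_map_C_iff.1 (h (C_mem_map_C_iff.2 ha)), fun h => Ideal.map_mono h⟩

variable [IsDomain R] {K : Type*} [Field K] [Algebra R K] [IsFractionRing R K]

theorem notMem_map_C_of_mem_unitVContent {M : Ideal R} (hM : IsGVFree K M) {g : MvPolynomial σ R}
    (hg : g ∈ unitVContent σ R K) : g ∉ M.map (MvPolynomial.C : R →+* MvPolynomial σ R) :=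
  fun h => hM _ (polyContent_le_iff_mem_map.2 h) (isGV_polyContent_of_mem hg)

/-- Divisibility in `R[X]` can be tested in `K[X]` and after multiplication by an element of
unit `v`-content. -/
theorem dvd_of_map_dvd_of_dvd_mul {g : MvPolynomial σ R} (hg : g ∈ unitVContent σ R K)
    {f w : MvPolynomial σ R} (hw : w ≠ 0)
    (hmap : MvPolynomial.map (algebraMap R K) w ∣ MvPolynomial.map (algebraMap R K) f)
    (hmul : w ∣ f * g) : w ∣ f := by
  have hinj : Function.Injective (MvPolynomial.map (σ := σ) (algebraMap R K)) :=
    MvPolynomial.map_injective _ (IsFractionRing.injective R K)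
  obtain ⟨h, hh⟩ := hmap
  obtain ⟨k, hk⟩ := hmul
  have hw' : MvPolynomial.map (algebraMap R K) w ≠ 0 := by rwa [Ne, map_eq_zero_iff _ hinj]
  obtain ⟨h', rfl⟩ := exists_map_eq_of_mul_mem hg (h := h) (f := k) (mul_left_cancel₀ hw' (by
    rw [← map_mul, ← hk, map_mul, hh]
    ring))
  exact ⟨h', hinj (by rw [hh, map_mul])⟩

variable {L : Type*} [Field L] [Algebra (MvPolynomial σ R) L] [IsFractionRing (MvPolynomial σ R) L]

/-- A finitely generated ideal containing an element of unit `v`-content is Glaz–Vasconcelos as soon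
as its extension to `K[X]` is. -/
theorem isGV_of_mem_unitVContent {J : Ideal (MvPolynomial σ R)} (hJ : J.FG)
    {g : MvPolynomial σ R} (hgJ : g ∈ J) (hg : g ∈ unitVContent σ R K)
    (h : ∀ f w : MvPolynomial σ R, (∀ r ∈ J, MvPolynomial.map (algebraMap R K) w ∣
      MvPolynomial.map (algebraMap R K) f * MvPolynomial.map (algebraMap R K) r) →
      MvPolynomial.map (algebraMap R K) w ∣ MvPolynomial.map (algebraMap R K) f) :
    IsGV L J := by
  refine isGV_iff_dvd.2 ⟨hJ, fun f w hw hr => dvd_of_map_dvd_of_dvd_mul hg hw ?_ (hr g hgJ)⟩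
  refine h f w fun r hrJ => ?_
  rw [← map_mul]
  exact map_dvd _ (hr r hrJ)

theorem isUnit_map_C {R K σ : Type*} [CommRing R] [Field K] [Algebra R K] [FaithfulSMul R K]
    {a : R} (ha : a ≠ 0) :
    IsUnit (MvPolynomial.C (algebraMap R K a) : MvPolynomial σ K) :=
  (IsUnit.mk0 _ ((FaithfulSMul.algebraMap_eq_zero_iff R K).not.2 ha)).map MvPolynomial.C

theorem IsGV.map_C {J : Ideal R} (hJ : IsGV K J) (h0 : J ≠ ⊥) :
    IsGV L (J.map (MvPolynomial.C : R →+* MvPolynomial σ R)) := by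
  have hinj : Function.Injective (MvPolynomial.map (σ := σ) (algebraMap R K)) :=
    MvPolynomial.map_injective _ (IsFractionRing.injective R K)
  refine isGV_iff_dvd.2 ⟨hJ.1.map _, fun f w hw hr => ?_⟩
  have hr : ∀ r ∈ J, w ∣ f * MvPolynomial.C r := fun r h => hr _ (Ideal.mem_map_of_mem _ h)
  have hw' : MvPolynomial.map (algebraMap R K) w ≠ 0 := by rwa [Ne, map_eq_zero_iff _ hinj]
  obtain ⟨a, ha, ha0⟩ := Submodule.exists_mem_ne_zero_of_ne_bot h0
  obtain ⟨h, hh⟩ : MvPolynomial.map (algebraMap R K) w ∣ MvPolynomial.map (algebraMap R K) f := by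
    have := map_dvd (MvPolynomial.map (algebraMap R K)) (hr a ha)
    rwa [map_mul, MvPolynomial.map_C, (isUnit_map_C ha0).dvd_mul_right] at this
  have hcoeff : ∀ d, h.coeff d ∈ (algebraMap R K).range := by
    refine fun d => hJ.2 _ fun r hrJ => ?_
    obtain ⟨k, hk⟩ := hr r hrJ
    have : h * MvPolynomial.C (algebraMap R K r) = MvPolynomial.map (algebraMap R K) k := by
      refine mul_left_cancel₀ hw' ?_
      rw [← map_mul, ← hk, map_mul, hh, MvPolynomial.map_C, mul_assoc]
    have := congrArg (MvPolynomial.coeff d) this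
    rw [mul_comm, MvPolynomial.coeff_C_mul, MvPolynomial.coeff_map] at this
    exact ⟨_, by rw [← this, mul_comm]⟩
  obtain ⟨h', rfl⟩ : h ∈ (MvPolynomial.map (algebraMap R K)).range :=
    MvPolynomial.mem_range_map_iff_coeffs_subset.2 fun c hc => by
      obtain ⟨d, -, rfl⟩ := MvPolynomial.mem_coeffs_iff.1 hc
      exact hcoeff d
  exact ⟨h', hinj (by rw [hh, map_mul])⟩

/-- `Q` is an upper to zero, `Q = p K[X] ∩ R[X]` for a prime element `p` of `K[X]`, that contains an
element of unit `v`-content. The maximal `t`-ideals of `R[X]` not extended from `R` are of this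
form. -/
def IsUpperToZero (Q : Ideal (MvPolynomial σ R)) (p : MvPolynomial σ K) : Prop :=
  Prime p ∧ (∀ f, f ∈ Q ↔ p ∣ MvPolynomial.map (algebraMap R K) f) ∧
    ∃ g ∈ Q, g ∈ unitVContent σ R K

theorem IsUpperToZero.C_notMem {Q : Ideal (MvPolynomial σ R)} {p : MvPolynomial σ K}
    (h : IsUpperToZero Q p) {a : R} (ha : a ≠ 0) : MvPolynomial.C a ∉ Q := by
  rw [h.2.1, MvPolynomial.map_C]
  exact fun hp => h.1.not_isUnit (isUnit_of_dvd_unit hp (isUnit_map_C ha))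

theorem IsUpperToZero.isPrime {Q : Ideal (MvPolynomial σ R)} {p : MvPolynomial σ K}
    (h : IsUpperToZero Q p) : Q.IsPrime := by
  refine ⟨fun htop => h.C_notMem one_ne_zero (htop ▸ trivial), fun {f g} hfg => ?_⟩
  rw [h.2.1, map_mul] at hfg
  exact (h.1.dvd_or_dvd hfg).imp (h.2.1 f).2 (h.2.1 g).2

theorem exists_isUpperToZero {Q : Ideal (MvPolynomial σ R)} (hQ : Q.IsPrime) (hfree : IsGVFree L Q)
    {g : MvPolynomial σ R} (hgQ : g ∈ Q) (hg : g ∈ unitVContent σ R K) :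
    ∃ p : MvPolynomial σ K, IsUpperToZero Q p := by
  have hinj : Function.Injective (MvPolynomial.map (σ := σ) (algebraMap R K)) :=
    MvPolynomial.map_injective _ (IsFractionRing.injective R K)
  have hC : ∀ a : R, a ≠ 0 → MvPolynomial.C a ∉ Q := by
    intro a ha haQ
    refine hfree (Ideal.span {MvPolynomial.C a, g})
      (Ideal.span_le.2 (by simp [Set.insert_subset_iff, haQ, hgQ]))
      (isGV_of_mem_unitVContent (Submodule.fg_span (by simp)) (Ideal.subset_span (by simp)) hg
        fun f w h => ?_)
    have := h (MvPolynomial.C a) (Ideal.subset_span (by simp))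
    rwa [MvPolynomial.map_C, (isUnit_map_C ha).dvd_mul_right] at this
  let _ := MvPolynomial.algebraMvPolynomial (σ := σ) (R := R) (S := K)
  have : IsLocalization (R⁰.map (MvPolynomial.C (σ := σ))) (MvPolynomial σ K) :=
    MvPolynomial.isLocalization R⁰ K
  have hdisj : Disjoint (R⁰.map (MvPolynomial.C (σ := σ)) : Set (MvPolynomial σ R)) Q := by
    rw [Set.disjoint_left]
    rintro _ ⟨a, ha, rfl⟩
    exact hC a (nonZeroDivisors.ne_zero ha)
  have hprime := IsLocalization.isPrime_of_isPrime_disjoint _ (MvPolynomial σ K) Q hQ hdisj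
  have hcomap := IsLocalization.under_map_of_isPrime_disjoint _ (MvPolynomial σ K) hQ hdisj
  rw [MvPolynomial.algebraMap_def] at hprime
  have hmem : ∀ f, MvPolynomial.map (algebraMap R K) f ∈ Q.map (MvPolynomial.map (algebraMap R K)) →
      f ∈ Q := by
    intro f hf
    rw [← hcomap]
    exact hf
  have hne : Q.map (MvPolynomial.map (algebraMap R K)) ≠ ⊥ := by
    intro h
    have := Ideal.mem_map_of_mem (MvPolynomial.map (algebraMap R K)) hgQ
    rw [h, Submodule.mem_bot, map_eq_zero_iff _ hinj] at this
    exact nonZeroDivisors.ne_zero (unitVContent_le K hg) this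
  obtain ⟨p, hpQ, hp⟩ := hprime.exists_mem_prime_of_ne_bot hne
  refine ⟨p, hp, fun f => ⟨fun hf => ?_, fun hpf => hmem f (Ideal.mem_of_dvd _ hpf hpQ)⟩,
    g, hgQ, hg⟩
  by_contra hpf
  -- `p` and `f` are coprime in `K[X]`; with `g` they give a Glaz–Vasconcelos ideal inside `Q`.
  obtain ⟨d, hd, f₂, hf₂⟩ := exists_C_mul_eq_map (R := R) p
  have hf₂Q : f₂ ∈ Q := hmem f₂ (by rw [hf₂]; exact Ideal.mul_mem_left _ _ hpQ)
  refine hfree (Ideal.span {f, f₂, g})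
    (Ideal.span_le.2 (by simp [Set.insert_subset_iff, hf, hf₂Q, hgQ]))
    (isGV_of_mem_unitVContent (Submodule.fg_span (by simp)) (Ideal.subset_span (by simp)) hg
      fun k w h => ?_)
  have h₂ := h f₂ (Ideal.subset_span (by simp))
  rw [hf₂, mul_left_comm, (isUnit_map_C hd).dvd_mul_left] at h₂
  exact dvd_of_dvd_mul_of_dvd_mul_prime hp hpf (h f (Ideal.subset_span (by simp))) h₂

end TMaxPolynomial

/-! ### Maximal `t`-ideals of localizations of `R[X]` -/

section TMaxLocalization

variable {R σ : Type*} [CommRing R]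

theorem C_dvd_iff_polyContent_le {b : R} {f : MvPolynomial σ R} :
    MvPolynomial.C b ∣ f ↔ polyContent f ≤ Ideal.span {b} := by
  rw [polyContent_le_iff_mem_map, Ideal.map_span, Set.image_singleton, Ideal.mem_span_singleton]

theorem polyContent_C_mul_le_iff {a b : R} {f : MvPolynomial σ R} :
    polyContent (MvPolynomial.C a * f) ≤ Ideal.span {b} ↔ ∀ c ∈ polyContent f, b ∣ a * c := by
  have : (∀ c ∈ polyContent f, b ∣ a * c) ↔ polyContent f ≤ (Ideal.span {b}).colon {a} := by
    refine forall₂_congr fun c _ => ?_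
    rw [Submodule.mem_colon_singleton, smul_eq_mul, Ideal.mem_span_singleton, mul_comm]
  rw [this, polyContent_le, polyContent_le]
  refine forall_congr' fun d => ?_
  rw [Submodule.mem_colon_singleton, smul_eq_mul, MvPolynomial.coeff_C_mul, mul_comm]

variable [IsDomain R] {K : Type*} [Field K] [Algebra R K]
  [IsFractionRing R K] {L : Type*} [Field L]
  {B : Type*} [CommRing B] [Algebra (MvPolynomial σ R) B] [Algebra B L]

theorem IsGVFree.map_C_map_algebraMap [IsDomain B] [IsFractionRing B L]
    {T : Submonoid (MvPolynomial σ R)} [IsLocalization T B] (hT : T ≤ unitVContent σ R K)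
    {M : Ideal R} (hM : IsGVFree K M) :
    IsGVFree L ((M.map (MvPolynomial.C : R →+* MvPolynomial σ R)).map
      (algebraMap (MvPolynomial σ R) B)) := by
  intro J hJM hJ
  rw [isGV_iff_dvd] at hJ
  obtain ⟨⟨s, rfl⟩, hJ⟩ := hJ
  have hs : ∀ r ∈ s, ∃ a ∈ M.map (MvPolynomial.C : R →+* MvPolynomial σ R), ∃ t ∈ T,
      r * algebraMap _ B t = algebraMap _ B a := by
    intro r hr
    obtain ⟨⟨⟨a, ha⟩, t, ht⟩, h⟩ :=
      (IsLocalization.mem_map_algebraMap_iff T B).1 (hJM (Ideal.subset_span hr))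
    exact ⟨a, ha, t, ht, h⟩
  choose! a ha t ht h using hs
  have hI := hM (s.sup fun r => polyContent (a r))
    (Finset.sup_le fun r hr => polyContent_le_iff_mem_map.2 (ha r hr))
  rw [isGV_iff_dvd] at hI
  refine hI ⟨Submodule.fg_finset_sup s _ fun r _ => polyContent_fg _, fun x b hb hx => ?_⟩
  have hinj : Function.Injective (algebraMap (MvPolynomial σ R) B) :=
    IsLocalization.injective B (hT.trans (unitVContent_le K))
  have hdvd : algebraMap (MvPolynomial σ R) B (MvPolynomial.C b) ∣
      algebraMap (MvPolynomial σ R) B (MvPolynomial.C x) := by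
    refine hJ _ _ ?_ fun r hr => ?_
    · rwa [Ne, map_eq_zero_iff _ hinj, MvPolynomial.C_eq_zero]
    induction hr using Submodule.span_induction with
    | mem r hr =>
      rw [← (IsLocalization.map_units B ⟨t r, ht r hr⟩).dvd_mul_right, mul_assoc]
      rw [h r hr, ← map_mul]
      refine map_dvd _ (C_dvd_iff_polyContent_le.2 (polyContent_C_mul_le_iff.2 fun c hc => ?_))
      exact hx c (Finset.le_sup (f := fun r => polyContent (a r)) hr hc)
    | zero => simp
    | add u v _ _ hu hv =>
      rw [mul_add]
      exact dvd_add hu hv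
    | smul u v _ hv =>
      rw [smul_eq_mul, mul_left_comm]
      exact hv.mul_left u
  obtain ⟨c, hc⟩ := hdvd
  obtain ⟨⟨k, u⟩, hk⟩ := IsLocalization.surj T c
  have hbk : MvPolynomial.C x * (u : MvPolynomial σ R) = MvPolynomial.C b * k := by
    apply hinj
    rw [map_mul, map_mul, ← hk, hc, mul_assoc]
  have hu := isGV_polyContent_of_mem (hT u.2)
  rw [isGV_iff_dvd] at hu
  exact hu.2 x b hb (polyContent_C_mul_le_iff.1 (C_dvd_iff_polyContent_le.1 ⟨k, hbk⟩))

variable [Algebra (MvPolynomial σ R) L] [IsFractionRing (MvPolynomial σ R) L]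

/-- A nonzero ideal of `R[X]` without Glaz–Vasconcelos subideals that avoids the elements of unit
`v`-content has a coefficient ideal without Glaz–Vasconcelos subideals. In at least one variable, a
finitely generated subideal of the coefficient ideal lies in the content of a single element. -/
theorem isGVFree_coeffIdeal {Q : Ideal (MvPolynomial σ R)} (hQ : IsGVFree L Q) (h0 : Q ≠ ⊥)
    (hS : ∀ g ∈ Q, g ∉ unitVContent σ R K) : IsGVFree K (coeffIdeal Q) := by
  intro J hJQ hJ
  obtain ⟨f₀, hf₀, hf₀'⟩ := Submodule.exists_mem_ne_zero_of_ne_bot h0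
  have hf₀c : polyContent f₀ ≠ ⊥ := by
    intro h
    refine hf₀' (MvPolynomial.ext _ _ fun d => ?_)
    have := coeff_mem_polyContent f₀ d
    rwa [h, Submodule.mem_bot] at this
  -- Enlarging `J` makes it nonzero, which matters if `R = K`.
  have hJ' : IsGV K (J ⊔ polyContent f₀) :=
    hJ.mono le_sup_left (Submodule.FG.sup hJ.1 (polyContent_fg f₀))
  have hJ'Q : J ⊔ polyContent f₀ ≤ coeffIdeal Q := sup_le hJQ (polyContent_le_coeffIdeal hf₀)
  have hJ'0 : J ⊔ polyContent f₀ ≠ ⊥ := fun h => hf₀c (le_bot_iff.1 (h ▸ le_sup_right))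
  rcases isEmpty_or_nonempty σ with hσ | hσ
  · refine hQ _ (Ideal.map_le_iff_le_comap.2 (hJ'Q.trans (iSup₂_le fun f hf => ?_)))
      (hJ'.map_C (L := L) hJ'0)
    obtain ⟨r, rfl⟩ := MvPolynomial.C_surjective σ f
    refine polyContent_le.2 fun d => ?_
    rw [Subsingleton.elim d 0, MvPolynomial.coeff_zero_C]
    exact hf
  · obtain ⟨g, hg, hJg⟩ := exists_le_polyContent hJ'.1 hJ'Q
    exact hS g hg (mem_unitVContent_of_isGV (hJ'.mono hJg (polyContent_fg g))
      fun h => hJ'0 (le_bot_iff.1 (h ▸ hJg)))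

variable [IsFractionRing B L] [IsScalarTower (MvPolynomial σ R) B L]

theorem under_map_C_map_algebraMap {T : Submonoid (MvPolynomial σ R)}
    [IsLocalization T B] (hT : T ≤ unitVContent σ R K) {M : Ideal R} (hM : M ∈ tMax R K) :
    ((M.map (MvPolynomial.C : R →+* MvPolynomial σ R)).map
      (algebraMap (MvPolynomial σ R) B)).under (MvPolynomial σ R) = M.map MvPolynomial.C := by
  rw [mem_tMax_iff] at hM
  refine IsLocalization.under_map_of_isPrime_disjoint T B
    (isPrime_map_C (isPrime_of_maximal_isGVFree hM)) (Set.disjoint_left.2 fun t ht => ?_)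
  exact notMem_map_C_of_mem_unitVContent hM.prop (hT ht)

variable [IsDomain B]

variable (K) in
/-- A maximal `t`-ideal of a localization of `R[X]` at elements of unit `v`-content contracts to
`M[X]` for a maximal `t`-ideal `M` of `R`, or to an upper to zero. -/
theorem under_eq_map_C_or_isUpperToZero {T : Submonoid (MvPolynomial σ R)} [IsLocalization T B]
    (hT : T ≤ unitVContent σ R K) {N : Ideal B} (hN : N ∈ tMax B L) :
    (∃ M ∈ tMax R K, N.under (MvPolynomial σ R) = M.map MvPolynomial.C) ∨
      ∃ p : MvPolynomial σ K, IsUpperToZero (N.under (MvPolynomial σ R)) p := by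
  have hN' := mem_tMax_iff.1 hN
  have hprime := isPrime_of_maximal_isGVFree hN'
  have hfree : IsGVFree L (N.under (MvPolynomial σ R)) := hN'.prop.under T
  by_cases h : ∃ g ∈ N.under (MvPolynomial σ R), g ∈ unitVContent σ R K
  · obtain ⟨g, hgN, hg⟩ := h
    exact Or.inr (exists_isUpperToZero (hprime.under _) hfree hgN hg)
  · push Not at h
    left
    have h0 : N.under (MvPolynomial σ R) ≠ ⊥ := by
      intro h0
      refine ne_bot_of_mem_tMax hN ?_
      rw [← IsLocalization.map_under T B N, h0, Ideal.map_bot]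
    obtain ⟨M, hQM, hM⟩ := (isGVFree_coeffIdeal hfree h0 h).exists_le_maximal
    refine ⟨M, mem_tMax_iff.2 hM, ?_⟩
    have hNM : N ≤ (M.map (MvPolynomial.C : R →+* MvPolynomial σ R)).map
        (algebraMap (MvPolynomial σ R) B) := by
      rw [← IsLocalization.map_under T B N]
      exact Ideal.map_mono (coeffIdeal_le_iff.1 hQM)
    rw [hN'.eq_of_le (hM.prop.map_C_map_algebraMap hT) hNM,
      under_map_C_map_algebraMap hT (mem_tMax_iff.2 hM)]

theorem map_C_map_algebraMap_mem_tMax {T : Submonoid (MvPolynomial σ R)} [IsLocalization T B]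
    (hT : T ≤ unitVContent σ R K) {M : Ideal R} (hM : M ∈ tMax R K) :
    (M.map (MvPolynomial.C : R →+* MvPolynomial σ R)).map (algebraMap (MvPolynomial σ R) B) ∈
      tMax B L := by
  have hM' := mem_tMax_iff.1 hM
  obtain ⟨N, hMN, hN⟩ := (hM'.prop.map_C_map_algebraMap (L := L) (B := B) hT).exists_le_maximal
  have hle : M.map (MvPolynomial.C : R →+* MvPolynomial σ R) ≤ N.under (MvPolynomial σ R) := by
    rw [← under_map_C_map_algebraMap (B := B) hT hM]
    exact Ideal.comap_mono hMN
  rcases under_eq_map_C_or_isUpperToZero K hT (mem_tMax_iff.2 hN) with ⟨M', hM₁, h⟩ | ⟨p, hp⟩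
  · rw [h, map_C_le_map_C_iff] at hle
    rw [hM'.eq_of_le (mem_tMax_iff.1 hM₁).prop hle, ← h, IsLocalization.map_under T B N]
    exact mem_tMax_iff.2 hN
  · obtain ⟨a, ha, ha0⟩ := Submodule.exists_mem_ne_zero_of_ne_bot (ne_bot_of_mem_tMax hM)
    exact absurd (hle (Ideal.mem_map_of_mem _ ha)) (hp.C_notMem ha0)

end TMaxLocalization

section Separation

variable {R σ : Type*} [CommRing R] [IsDomain R] {K : Type*} [Field K] [Algebra R K]
  [IsFractionRing R K] {L : Type*} [Field L] [Algebra (MvPolynomial σ R) L]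
  [IsFractionRing (MvPolynomial σ R) L]

variable (R σ K L) in
/-- Every `R[X]_{M[X]}`, with `M` a maximal `t`-ideal of `R`, omits an element of the quotient field
lying in `R[X]_{M'[X]}` for all maximal `t`-ideals `M' ≠ M` of `R`. -/
def IsExtendedTSharp : Prop :=
  ∀ M ∈ tMax R K, ∃ x : L,
    x ∉ localizationAt L (M.map (MvPolynomial.C : R →+* MvPolynomial σ R)) ∧
    ∀ M' ∈ tMax R K, M' ≠ M →
      x ∈ localizationAt L (M'.map (MvPolynomial.C : R →+* MvPolynomial σ R))

/-- For an upper to zero `Q = p K[X] ∩ R[X]`, a suitable `e / p` with `0 ≠ e ∈ R` lies in all the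
other localizations. -/
theorem IsUpperToZero.exists_separating {Q : Ideal (MvPolynomial σ R)} {p : MvPolynomial σ K}
    (hQ : IsUpperToZero Q p) : ∃ x : L, x ∉ localizationAt L Q ∧
      (∀ M ∈ tMax R K, x ∈ localizationAt L (M.map (MvPolynomial.C : R →+* MvPolynomial σ R))) ∧
      ∀ (Q' : Ideal (MvPolynomial σ R)) (p' : MvPolynomial σ K), IsUpperToZero Q' p' → Q' ≠ Q →
        x ∈ localizationAt L Q' := by
  have hinj : Function.Injective (MvPolynomial.map (σ := σ) (algebraMap R K)) :=
    MvPolynomial.map_injective _ (IsFractionRing.injective R K)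
  have hinjL := IsFractionRing.injective (MvPolynomial σ R) L
  obtain ⟨hp, hmem, g, hgQ, hg⟩ := id hQ
  obtain ⟨h, hh⟩ := (hmem g).1 hgQ
  obtain ⟨d, hd, p₁, hp₁⟩ := exists_C_mul_eq_map (R := R) p
  obtain ⟨e, he, h₁, hh₁⟩ := exists_C_mul_eq_map (R := R) h
  have hp₁0 : p₁ ≠ 0 := by
    rintro rfl
    rw [map_zero] at hp₁
    exact mul_ne_zero (isUnit_map_C hd).ne_zero hp.ne_zero hp₁.symm
  have hp₁L : algebraMap _ L p₁ ≠ 0 := by rwa [Ne, map_eq_zero_iff _ hinjL]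
  refine ⟨algebraMap (MvPolynomial σ R) L (MvPolynomial.C (e * d)) / algebraMap _ L p₁, ?_, ?_, ?_⟩
  · rintro ⟨a, s, hs, has⟩
    have hs0 : algebraMap _ L s ≠ 0 := by
      rw [Ne, map_eq_zero_iff _ hinjL]
      exact fun h => hs (h ▸ Q.zero_mem)
    rw [div_eq_div_iff hp₁L hs0, ← map_mul, ← map_mul] at has
    have := congrArg (MvPolynomial.map (algebraMap R K)) (hinjL has)
    rw [map_mul _ (MvPolynomial.C (e * d)) s, map_mul _ a p₁, hp₁, MvPolynomial.map_C] at this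
    refine hs ((hmem s).2 ((isUnit_map_C (σ := σ) (K := K) (mul_ne_zero he hd)).dvd_mul_left.1 ?_))
    rw [this]
    exact ((dvd_mul_left _ _).mul_left _)
  · intro M hM
    refine ⟨h₁, g, notMem_map_C_of_mem_unitVContent (mem_tMax_iff.1 hM).prop hg, ?_⟩
    have hgL : algebraMap _ L g ≠ 0 := by
      rw [Ne, map_eq_zero_iff _ hinjL]
      exact nonZeroDivisors.ne_zero (unitVContent_le K hg)
    rw [div_eq_div_iff hp₁L hgL, ← map_mul, ← map_mul]
    congr 1
    apply hinj
    simp only [map_mul, MvPolynomial.map_C, hp₁, hh, hh₁]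
    ring
  · intro Q' p' hQ' hne
    refine ⟨_, p₁, fun h => hne ?_, rfl⟩
    rw [hQ'.2.1, hp₁, (isUnit_map_C hd).dvd_mul_left] at h
    have hassoc := hQ'.1.associated_of_dvd hp h
    ext f
    rw [hQ'.2.1, hmem, hassoc.dvd_iff_dvd_left]

/-- An element of unit `v`-content may be chosen so that multiplying by it removes a given
denominator `w` at all uppers to zero simultaneously. -/
theorem exists_mem_unitVContent_forall_isUpperToZero (w : MvPolynomial σ K) (hw : w ≠ 0) :
    ∃ g ∈ unitVContent σ R K, ∀ (Q : Ideal (MvPolynomial σ R)) (p : MvPolynomial σ K),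
      IsUpperToZero Q p → ∃ f ∉ Q,
        w ∣ MvPolynomial.map (algebraMap R K) f * MvPolynomial.map (algebraMap R K) g := by
  induction w using UniqueFactorizationMonoid.induction_on_prime with
  | h₁ => exact absurd rfl hw
  | h₂ u hu =>
    exact ⟨1, one_mem _, fun Q p hQ => ⟨1, hQ.isPrime.one_notMem, hu.dvd⟩⟩
  | h₃ w q hw0 hq ih =>
    obtain ⟨g, hg, h⟩ := ih hw0
    by_cases hqg : ∃ g' ∈ unitVContent σ R K, q ∣ MvPolynomial.map (algebraMap R K) g'
    · obtain ⟨g', hg', hqg'⟩ := hqg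
      refine ⟨g' * g, mul_mem hg' hg, fun Q p hQ => ?_⟩
      obtain ⟨f, hf, hwf⟩ := h Q p hQ
      refine ⟨f, hf, ?_⟩
      rw [map_mul, mul_left_comm]
      exact mul_dvd_mul hqg' hwf
    · push Not at hqg
      refine ⟨g, hg, fun Q p hQ => ?_⟩
      obtain ⟨f, hf, hwf⟩ := h Q p hQ
      obtain ⟨d, hd, q₁, hq₁⟩ := exists_C_mul_eq_map (R := R) q
      refine ⟨q₁ * f, fun hmem => ?_, ?_⟩
      · obtain ⟨hp, hQp, g', hg'Q, hg'⟩ := id hQ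
        have := (hQp q₁).1 ((hQ.isPrime.mem_or_mem hmem).resolve_right hf)
        rw [hq₁, (isUnit_map_C hd).dvd_mul_left] at this
        exact hqg g' hg' ((hp.associated_of_dvd hq this).dvd_iff_dvd_left.1 ((hQp g').1 hg'Q))
      · rw [map_mul, hq₁, mul_assoc, mul_assoc]
        exact (mul_dvd_mul_left q hwf).mul_left _

theorem exists_mul_mem_localizationAt (x : L) : ∃ g ∈ unitVContent σ R K,
    ∀ (Q : Ideal (MvPolynomial σ R)) (p : MvPolynomial σ K), IsUpperToZero Q p →
      algebraMap _ L g * x ∈ localizationAt L Q := by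
  have hinj : Function.Injective (MvPolynomial.map (σ := σ) (algebraMap R K)) :=
    MvPolynomial.map_injective _ (IsFractionRing.injective R K)
  have hinjL := IsFractionRing.injective (MvPolynomial σ R) L
  obtain ⟨a, b, hb, rfl⟩ := IsFractionRing.div_surjective (MvPolynomial σ R) x
  have hb := nonZeroDivisors.ne_zero hb
  obtain ⟨g, hg, h⟩ := exists_mem_unitVContent_forall_isUpperToZero (R := R)
    (MvPolynomial.map (algebraMap R K) b) (by rwa [Ne, map_eq_zero_iff _ hinj])
  refine ⟨g, hg, fun Q p hQ => ?_⟩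
  obtain ⟨f, hf, k, hk⟩ := h Q p hQ
  obtain ⟨e, he, k₁, hk₁⟩ := exists_C_mul_eq_map (R := R) k
  have hef : MvPolynomial.C e * f ∉ Q := fun h =>
    (hQ.isPrime.mem_or_mem h).elim (hQ.C_notMem he) hf
  refine ⟨a * k₁, MvPolynomial.C e * f, hef, ?_⟩
  have hbL : algebraMap _ L b ≠ 0 := by rwa [Ne, map_eq_zero_iff _ hinjL]
  have hefL : algebraMap (MvPolynomial σ R) L (MvPolynomial.C e * f) ≠ 0 := by
    rw [Ne, map_eq_zero_iff _ hinjL]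
    exact fun h => hef (h ▸ Q.zero_mem)
  rw [← mul_div_assoc, div_eq_div_iff hbL hefL, ← map_mul, ← map_mul, ← map_mul]
  congr 1
  apply hinj
  simp only [map_mul, MvPolynomial.map_C]
  rw [hk₁]
  linear_combination (MvPolynomial.map (algebraMap R K) a) *
    (MvPolynomial.C (algebraMap R K e)) * hk

theorem mul_mem_localizationAt_iff {M : Ideal R} (hM : M ∈ tMax R K) {g : MvPolynomial σ R}
    (hg : g ∈ unitVContent σ R K) {x : L} :
    algebraMap _ L g * x ∈ localizationAt L (M.map (MvPolynomial.C : R →+* MvPolynomial σ R)) ↔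
      x ∈ localizationAt L (M.map (MvPolynomial.C : R →+* MvPolynomial σ R)) := by
  have hgL : algebraMap _ L g ≠ 0 := by
    rw [Ne, map_eq_zero_iff _ (IsFractionRing.injective (MvPolynomial σ R) L)]
    exact nonZeroDivisors.ne_zero (unitVContent_le K hg)
  have hM := mem_tMax_iff.1 hM
  have hprime := isPrime_map_C (σ := σ) (isPrime_of_maximal_isGVFree hM)
  constructor
  · rintro ⟨a, s, hs, h⟩
    refine ⟨a, g * s, fun hgs => (hprime.mem_or_mem hgs).elim
      (notMem_map_C_of_mem_unitVContent hM.prop hg) hs, ?_⟩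
    rw [map_mul, mul_comm (algebraMap _ L g), ← div_div, ← h, mul_div_cancel_left₀ _ hgL]
  · rintro ⟨a, s, hs, rfl⟩
    exact ⟨g * a, s, hs, by rw [map_mul, mul_div_assoc]⟩

variable {B : Type*} [CommRing B] [IsDomain B] [Algebra (MvPolynomial σ R) B] [Algebra B L]
  [IsFractionRing B L] [IsScalarTower (MvPolynomial σ R) B L]

/-- For a localization of `R[X]` at elements of unit `v`-content, being a `t#`-domain is a condition
on the extended maximal `t`-ideals only, and so does not depend on the localization. -/
theorem isTSharpDomain_iff_isExtendedTSharp (T : Submonoid (MvPolynomial σ R)) [IsLocalization T B]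
    (hT : T ≤ unitVContent σ R K) : IsTSharpDomain B L ↔ IsExtendedTSharp R σ K L := by
  have hloc : ∀ N ∈ tMax B L,
      localizationAt L N = localizationAt L (N.under (MvPolynomial σ R)) :=
    fun N hN => localizationAt_eq_under T (isPrime_of_maximal_isGVFree (mem_tMax_iff.1 hN))
  rw [isTSharpDomain_iff]
  constructor
  · intro h M hM
    have hmemM := map_C_map_algebraMap_mem_tMax (L := L) (B := B) hT hM
    obtain ⟨x, hx, hx'⟩ := h _ hmemM
    rw [hloc _ hmemM, under_map_C_map_algebraMap hT hM] at hx
    refine ⟨x, hx, fun M' hM' hne => ?_⟩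
    have hmem := map_C_map_algebraMap_mem_tMax (L := L) (B := B) hT hM'
    have := hx' _ hmem fun heq => hne (le_antisymm ?_ ?_)
    · rwa [hloc _ hmem, under_map_C_map_algebraMap hT hM'] at this
    all_goals
      rw [← map_C_le_map_C_iff (σ := σ), ← under_map_C_map_algebraMap (B := B) hT hM',
        ← under_map_C_map_algebraMap (B := B) hT hM, heq]
  · intro h N hN
    have hinj : ∀ N' : Ideal B, N' ≠ N →
        N'.under (MvPolynomial σ R) ≠ N.under (MvPolynomial σ R) := by
      intro N' hne heq
      exact hne (by rw [← IsLocalization.map_under T B N', heq, IsLocalization.map_under T B N])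
    rcases under_eq_map_C_or_isUpperToZero K hT hN with ⟨M, hM, hNM⟩ | ⟨p, hp⟩
    · obtain ⟨x, hx, hx'⟩ := h M hM
      obtain ⟨g, hg, hgx⟩ := exists_mul_mem_localizationAt (R := R) (σ := σ) (K := K) x
      refine ⟨algebraMap _ L g * x, ?_, fun N' hN' hne => ?_⟩
      · rwa [hloc N hN, hNM, mul_mem_localizationAt_iff hM hg]
      · rw [hloc N' hN']
        rcases under_eq_map_C_or_isUpperToZero K hT hN' with ⟨M', hM', hNM'⟩ | ⟨p, hp⟩
        · rw [hNM', mul_mem_localizationAt_iff hM' hg]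
          refine hx' M' hM' ?_
          rintro rfl
          exact hinj N' hne (hNM'.trans hNM.symm)
        · exact hgx _ p hp
    · obtain ⟨x, hx, hxM, hxQ⟩ := hp.exists_separating (L := L)
      refine ⟨x, by rwa [hloc N hN], fun N' hN' hne => ?_⟩
      rw [hloc N' hN']
      rcases under_eq_map_C_or_isUpperToZero K hT hN' with ⟨M', hM', hNM'⟩ | ⟨p', hp'⟩
      · rw [hNM']
        exact hxM M' hM'
      · exact hxQ _ p' hp' (hinj N' hne)

end Separation

/-! ### `v`-coherence and descent to `R` -/

section VCoherent

/-- In a `v`-coherent domain every conductor `(A : x)` is the `t`-closure of a finitely generated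
ideal: for `x = a / b` it equals `b (a, b)⁻¹`. -/
theorem IsVCoherent.exists_fg_tHull {A K : Type*} [CommRing A] [IsDomain A] [Field K] [Algebra A K]
    [IsFractionRing A K] (h : IsVCoherent A K) (x : K) : ∃ I : Ideal A, I.FG ∧
      (∀ r ∈ I, x * algebraMap A K r ∈ (algebraMap A K).range) ∧
      ∀ f, x * algebraMap A K f ∈ (algebraMap A K).range → f ∈ tHull K I := by
  classical
  obtain ⟨a, b, hb, rfl⟩ := IsFractionRing.div_surjective A x
  have hb := nonZeroDivisors.ne_zero hb
  have hbK : algebraMap A K b ≠ 0 := (FaithfulSMul.algebraMap_eq_zero_iff A K).not.2 hb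
  have hab0 : Ideal.span {a, b} ≠ ⊥ := fun h0 =>
    hb ((Submodule.eq_bot_iff _).1 h0 b (Ideal.subset_span (by simp)))
  obtain ⟨J, ⟨s, hs⟩, hJ⟩ := h (Ideal.span {a, b}) hab0 (Submodule.fg_span (by simp))
  have hmem : ∀ z : K, z ∈ ((Ideal.span {a, b} : Ideal A) : FractionalIdeal A⁰ K)⁻¹ ↔
      z * algebraMap A K a ∈ (algebraMap A K).range ∧
        z * algebraMap A K b ∈ (algebraMap A K).range := by
    intro z
    rw [FractionalIdeal.mem_inv_iff (FractionalIdeal.coeIdeal_ne_zero.2 hab0)]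
    constructor
    · intro hz
      exact ⟨(FractionalIdeal.mem_one_iff _).1
          (hz _ (FractionalIdeal.mem_coeIdeal_of_mem _ (Ideal.subset_span (by simp)))),
        (FractionalIdeal.mem_one_iff _).1
          (hz _ (FractionalIdeal.mem_coeIdeal_of_mem _ (Ideal.subset_span (by simp))))⟩
    · rintro ⟨hza, hzb⟩ y hy
      obtain ⟨r, hr, rfl⟩ := (FractionalIdeal.mem_coeIdeal _).1 hy
      obtain ⟨c, d, rfl⟩ := Ideal.mem_span_pair.1 hr
      refine (FractionalIdeal.mem_one_iff _).2 ?_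
      rw [map_add, map_mul, map_mul, mul_add, mul_left_comm, mul_left_comm z]
      exact add_mem (mul_mem (RingHom.mem_range_self _ c) hza)
        (mul_mem (RingHom.mem_range_self _ d) hzb)
  have hv0 : vClosure J ≠ 0 := by
    intro h0
    have : (1 : K) ∈ ((Ideal.span {a, b} : Ideal A) : FractionalIdeal A⁰ K)⁻¹ :=
      (hmem 1).2 ⟨⟨a, by simp⟩, ⟨b, by simp⟩⟩
    rw [hJ, h0] at this
    exact one_ne_zero ((FractionalIdeal.mem_zero_iff _).1 this)
  have hJinv : J⁻¹ ≠ 0 := fun h0 => hv0 (by rw [vClosure, h0, FractionalIdeal.inv_zero'])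
  have hJ0 : J ≠ 0 := fun h0 => hJinv (by rw [h0, FractionalIdeal.inv_zero'])
  have hle : ∀ j ∈ J, j ∈ ((Ideal.span {a, b} : Ideal A) : FractionalIdeal A⁰ K)⁻¹ := by
    intro j hj
    rw [hJ, vClosure, FractionalIdeal.mem_inv_iff hJinv]
    intro y hy
    rw [mul_comm]
    exact (FractionalIdeal.mem_inv_iff hJ0).1 hy j hj
  have hsJ : ∀ j ∈ s, j ∈ J := by
    intro j hj
    rw [← FractionalIdeal.mem_coe, ← hs]
    exact Submodule.subset_span hj
  -- `b J` is an integral ideal; `c j = b j` for the generators `j` of `J`.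
  choose! c hc using fun j (hj : j ∈ s) => ((hmem j).1 (hle j (hsJ j hj))).2
  have hI : (Ideal.span (s.image c : Set A)).FG := ⟨s.image c, rfl⟩
  refine ⟨Ideal.span (s.image c : Set A), hI, fun r hr => ?_, fun f hf => ?_⟩
  · induction hr using Submodule.span_induction with
    | mem r hr =>
      obtain ⟨j, hj, rfl⟩ := Finset.mem_image.1 hr
      rw [hc j hj, mul_comm j, ← mul_assoc, div_mul_cancel₀ _ hbK, mul_comm]
      exact ((hmem j).1 (hle j (hsJ j hj))).1
    | zero => simp
    | add u v _ _ hu hv =>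
      rw [map_add, mul_add]
      exact add_mem hu hv
    | smul u v _ hv =>
      rw [smul_eq_mul, map_mul, mul_left_comm]
      exact mul_mem ⟨u, rfl⟩ hv
  · refine ⟨_, hI, le_rfl, fun y hy => ?_⟩
    have hfJ : algebraMap A K f / algebraMap A K b ∈ vClosure J := by
      rw [← hJ, hmem]
      refine ⟨?_, ⟨f, by rw [div_mul_cancel₀ _ hbK]⟩⟩
      rwa [div_mul_eq_mul_div, mul_comm, ← div_mul_eq_mul_div]
    have hyJ : y * algebraMap A K b ∈ J⁻¹ := by
      rw [FractionalIdeal.mem_inv_iff hJ0]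
      intro j hj
      rw [← FractionalIdeal.mem_coe, ← hs] at hj
      refine (FractionalIdeal.mem_one_iff _).2 ?_
      change _ ∈ (algebraMap A K).range
      induction hj using Submodule.span_induction with
      | mem j hj =>
        rw [mul_assoc, mul_comm _ j, ← hc j hj]
        exact hy _ (Ideal.subset_span (Finset.mem_coe.2 (Finset.mem_image_of_mem c hj)))
      | zero => simp
      | add u v _ _ hu hv =>
        rw [mul_add]
        exact add_mem hu hv
      | smul u v _ hv =>
        rw [Algebra.smul_def, mul_left_comm]
        exact mul_mem ⟨u, rfl⟩ hv
    have := (FractionalIdeal.mem_one_iff _).1 ((FractionalIdeal.mem_inv_iff hJinv).1 hfJ _ hyJ)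
    rwa [mul_comm y, ← mul_assoc, div_mul_cancel₀ _ hbK, mul_comm] at this

variable {R σ : Type*} [CommRing R] {K : Type*} [Field K] [Algebra R K]
  [IsFractionRing R K] {L : Type*} [Field L] [Algebra (MvPolynomial σ R) L]
  [IsFractionRing (MvPolynomial σ R) L]

theorem C_div_C_mem_localizationAt_iff {M : Ideal R} (a : R) {b : R} (hb : b ≠ 0) :
    algebraMap (MvPolynomial σ R) L (MvPolynomial.C a) /
        algebraMap (MvPolynomial σ R) L (MvPolynomial.C b) ∈
      localizationAt L (M.map (MvPolynomial.C : R →+* MvPolynomial σ R)) ↔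
    algebraMap R K a / algebraMap R K b ∈ localizationAt K M := by
  have hinjL := IsFractionRing.injective (MvPolynomial σ R) L
  have hinjK := IsFractionRing.injective R K
  have hbK : algebraMap R K b ≠ 0 := by rwa [Ne, map_eq_zero_iff _ hinjK]
  have hbL : algebraMap (MvPolynomial σ R) L (MvPolynomial.C b) ≠ 0 := by
    rwa [Ne, map_eq_zero_iff _ hinjL, MvPolynomial.C_eq_zero]
  constructor
  · rintro ⟨f, s, hs, h⟩
    have hs0 : algebraMap (MvPolynomial σ R) L s ≠ 0 := by
      rw [Ne, map_eq_zero_iff _ hinjL]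
      exact fun h => hs (h ▸ Ideal.zero_mem _)
    rw [div_eq_div_iff hbL hs0, ← map_mul, ← map_mul] at h
    have h := hinjL h
    rw [MvPolynomial.mem_map_C_iff] at hs
    push Not at hs
    obtain ⟨d, hd⟩ := hs
    refine ⟨f.coeff d, s.coeff d, hd, ?_⟩
    have hd0 : algebraMap R K (s.coeff d) ≠ 0 := by
      rw [Ne, map_eq_zero_iff _ hinjK]
      exact fun h => hd (h ▸ M.zero_mem)
    have := congrArg (MvPolynomial.coeff d) h
    rw [mul_comm f, MvPolynomial.coeff_C_mul, MvPolynomial.coeff_C_mul, mul_comm b] at this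
    rw [div_eq_div_iff hbK hd0, ← map_mul, ← map_mul, this]
  · rintro ⟨c, s, hs, h⟩
    have hs0 : s ≠ 0 := fun h => hs (h ▸ M.zero_mem)
    have hsK : algebraMap R K s ≠ 0 := by rwa [Ne, map_eq_zero_iff _ hinjK]
    have hsL : algebraMap (MvPolynomial σ R) L (MvPolynomial.C s) ≠ 0 := by
      rwa [Ne, map_eq_zero_iff _ hinjL, MvPolynomial.C_eq_zero]
    refine ⟨MvPolynomial.C c, MvPolynomial.C s, C_mem_map_C_iff.not.2 hs, ?_⟩
    rw [div_eq_div_iff hbK hsK, ← map_mul, ← map_mul] at h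
    rw [div_eq_div_iff hbL hsL, ← map_mul, ← map_mul, ← map_mul, ← map_mul, hinjK h]

variable [IsDomain R]

theorem isExtendedTSharp_of_isTSharpDomain (h : IsTSharpDomain R K) :
    IsExtendedTSharp R σ K L := by
  intro M hM
  obtain ⟨x, hx, hx'⟩ := isTSharpDomain_iff.1 h M hM
  obtain ⟨a, b, hb, rfl⟩ := IsFractionRing.div_surjective R x
  have hb := nonZeroDivisors.ne_zero hb
  exact ⟨algebraMap _ L (MvPolynomial.C a) / algebraMap _ L (MvPolynomial.C b),
    (C_div_C_mem_localizationAt_iff a hb).not.2 hx,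
    fun M' hM' hne => (C_div_C_mem_localizationAt_iff a hb).2 (hx' M' hM' hne)⟩

theorem tHull_map_C {M : Ideal R} (hM : M ∈ tMax R K) :
    tHull L (M.map (MvPolynomial.C : R →+* MvPolynomial σ R)) = M.map MvPolynomial.C := by
  have : IsLocalization (⊥ : Submonoid (MvPolynomial σ R)) (MvPolynomial σ R) :=
    IsLocalization.self bot_le
  have h := map_C_map_algebraMap_mem_tMax (L := L) (B := MvPolynomial σ R) (K := K)
    (T := (⊥ : Submonoid (MvPolynomial σ R))) bot_le hM
  rw [Algebra.algebraMap_self, Ideal.map_id] at h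
  have h : Maximal (fun I : Ideal (MvPolynomial σ R) => I ≠ ⊤ ∧ IsTIdeal L I) _ := h
  exact (isTIdeal_iff.1 h.prop.2).2

/-- The conductor `(R[X] : x)` of a separating element is `I_v` with `I` finitely generated. The
coefficients of `I` generate a finitely generated ideal contained in `M` and in no other maximal
`t`-ideal, and any `y ∈ K \ R` multiplying it into `R` separates `M` from the others. -/
theorem isTSharpDomain_of_isExtendedTSharp (hcoh : IsVCoherent (MvPolynomial σ R) L)
    (h : IsExtendedTSharp R σ K L) : IsTSharpDomain R K := by
  rw [isTSharpDomain_iff]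
  intro M hM
  obtain ⟨x, hx, hx'⟩ := h M hM
  obtain ⟨I, hI, hxI, hIx⟩ := hcoh.exists_fg_tHull x
  have hinjL := IsFractionRing.injective (MvPolynomial σ R) L
  have hDM : coeffIdeal I ≤ M := by
    refine coeffIdeal_le_iff.2 fun r hr => ?_
    by_contra hrM
    obtain ⟨a, ha⟩ := hxI r hr
    refine hx ⟨a, r, hrM, ?_⟩
    rw [ha, mul_div_cancel_right₀]
    rw [Ne, map_eq_zero_iff _ hinjL]
    exact fun h => hrM (h ▸ Ideal.zero_mem _)
  have hDM' : ∀ M' ∈ tMax R K, M' ≠ M → ¬ coeffIdeal I ≤ M' := by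
    intro M' hM' hne hle
    obtain ⟨c, s, hs, rfl⟩ := hx' M' hM' hne
    have hs0 : algebraMap (MvPolynomial σ R) L s ≠ 0 := by
      rw [Ne, map_eq_zero_iff _ hinjL]
      exact fun h => hs (h ▸ Ideal.zero_mem _)
    obtain ⟨J, hJ, hJI, hJs⟩ := hIx s ⟨c, by rw [div_mul_cancel₀ _ hs0]⟩
    rw [← tHull_map_C (L := L) hM'] at hs
    exact hs ⟨J, hJ, hJI.trans (coeffIdeal_le_iff.1 hle), hJs⟩
  have hD : ¬ IsGV K (coeffIdeal I) := (mem_tMax_iff.1 hM).prop _ hDM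
  rw [IsGV] at hD
  push Not at hD
  obtain ⟨y, hyD, hy⟩ := hD (coeffIdeal_fg hI)
  have hyM' : ∀ M' ∈ tMax R K, M' ≠ M → y ∈ localizationAt K M' := by
    intro M' hM' hne
    obtain ⟨d, hd, hdM'⟩ := SetLike.not_le_iff_exists.1 (hDM' M' hM' hne)
    obtain ⟨c, hc⟩ := hyD d hd
    refine ⟨c, d, hdM', ?_⟩
    rw [hc, mul_div_cancel_right₀]
    rw [Ne, FaithfulSMul.algebraMap_eq_zero_iff]
    exact fun h => hdM' (h ▸ M'.zero_mem)
  refine ⟨y, fun hyM => hy (mem_range_of_forall_mem_localizationAt fun M' hM' => ?_), hyM'⟩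
  by_cases hne : M' = M
  · rwa [hne]
  · exact hyM' M' hM' hne

end VCoherent

theorem theorem3p6 {R σ : Type*} [CommRing R] [IsDomain R]
    (K : Type*) [Field K] [Algebra R K] [IsFractionRing R K]
    (L : Type*) [Field L] [Algebra (MvPolynomial σ R) L] [IsFractionRing (MvPolynomial σ R) L] :
    List.TFAE [
      IsTSharpDomain (MvPolynomial σ R) L,
      IsTSharpDomain (unitContentRing σ R L) L,
      IsTSharpDomain (unitVContentRing σ R K L) L] ∧
    (IsVCoherent (MvPolynomial σ R) L →
      List.TFAE [
        IsTSharpDomain (MvPolynomial σ R) L,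
        IsTSharpDomain (unitContentRing σ R L) L,
        IsTSharpDomain (unitVContentRing σ R K L) L,
        IsTSharpDomain R K]) := by
  have : IsLocalization (⊥ : Submonoid (MvPolynomial σ R)) (MvPolynomial σ R) :=
    IsLocalization.self bot_le
  have h₁ : IsTSharpDomain (MvPolynomial σ R) L ↔ IsExtendedTSharp R σ K L :=
    isTSharpDomain_iff_isExtendedTSharp ⊥ bot_le
  have h₂ : IsTSharpDomain (unitContentRing σ R L) L ↔ IsExtendedTSharp R σ K L :=
    isTSharpDomain_iff_isExtendedTSharp (unitContent σ R) unitContent_le_unitVContent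
  have h₃ : IsTSharpDomain (unitVContentRing σ R K L) L ↔ IsExtendedTSharp R σ K L :=
    isTSharpDomain_iff_isExtendedTSharp (unitVContent σ R K) le_rfl
  refine ⟨?_, fun hcoh => ?_⟩
  · rw [h₁, h₂, h₃]
    tfae_finish
  · have h₄ : IsTSharpDomain R K ↔ IsExtendedTSharp R σ K L :=
      ⟨isExtendedTSharp_of_isTSharpDomain, isTSharpDomain_of_isExtendedTSharp hcoh⟩
    rw [h₁, h₂, h₃, h₄]
    tfae_finish
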